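/- **One-pass triangle sampling in adjacency-list streams.** *Model.* Let $G$ be a simple graph with vertex set $\{1,\dots,n\}$ and $m$ edges, and let $t(G)$ be its set of triangles. In the adjacency list model the vertices of $G$ are revealed in an arbitrary order, and when a vertex $v$ is revealed, the edges $\{v,w\}$ at $v$ arrive one by one in an arbitrary order as tokens $(v,w)$; so every edge arrives twice. A one-pass streaming algorithm reads this sequence once from left to right. After each token it passes to a new memory state, chosen at random with a distribution that depends only on its current state and the token, and at the end of the stream it reports an output, again chosen at random depending only on its state. States are encoded injectively as bit strings, and the algorithm uses space $S$ on a stream if every state that can occur with positive probability at some point of the stream (before the first token and after the last one included) is encoded by at most $S$ bits. *Theorem.* There are $a,b\in\mathbb N$ such that for every $c\in\mathbb N$ there is $C>0$ with the following property. For all $n\in\mathbb N$, all integers $T\ge 1$ and all real $\varepsilon\in(0,2)$ there is a randomized one-pass streaming algorithm (which knows $n,T,\varepsilon$ and $c$, but not $m$ or $|t(G)|$) such that for every graph $G$ on $\{1,\dots,n\}$ with $|t(G)|\ge T$ and every adjacency list stream of $G$: 1. the algorithm uses at most $C\cdot\dfrac{m}{\sqrt T}\cdot(\log n)^a\cdot(1/\varepsilon)^b=\widetilde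 O(m/\sqrt T)$ bits of space, whatever its random choices; 2. it reports either a triangle of $G$ or failure, and failure has probability at most $n^{-c}$; 3. there is a probability distribution $\mathcal D$ on $t(G)$ whose $\ell_1$-distance to the uniform distribution $\mathcal U$ on $t(G)$ satisfies $\sum_{\Delta\in t(G)}|\mathcal D(\Delta)-\mathcal U(\Delta)|\le\varepsilon$, such that $\Pr[\text{the algorithm reports }\Delta]=(1-\Pr[\text{failure}])\cdot\mathcal D(\Delta)$ for every $\Delta\in t(G)$; that is, conditioned on not failing, the reported triangle has distribution $\mathcal D$. -/

import Mathlib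

namespace TriangleStream

/-- A randomized one-pass streaming algorithm reading tokens of type `Tok` one by one, in the
order of the stream, and reporting an element of `Out` when the stream has ended.  Everything it
remembers between two tokens, including any random choice it wants to use again, is its `State`.
`enc` writes states as bit strings, different states as different strings, so that the length of
`enc q` is the number of bits of memory occupied by the state `q`. -/
structure Algorithm (Tok Out : Type) where
  State : Type
  enc : State → List Bool
  enc_injective : Function.Injective enc
  init : PMF State
  step : State → Tok → PMF State
  report : State → PMF Out

namespace Algorithm

variable {Tok Out : Type}

/-- The distribution of the state after the tokens of `s` have been read (once, from left to
right), with fresh independent randomness in every step. -/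
noncomputable def run (A : Algorithm Tok Out) (s : List Tok) : PMF A.State :=
  s.foldl (fun p t => p.bind fun q => A.step q t) A.init

/-- The distribution of what is reported at the end of the stream `s`. -/
noncomputable def output (A : Algorithm Tok Out) (s : List Tok) : PMF Out :=
  (A.run s).bind A.report

/-- On the stream `s` the algorithm never holds more than `S` bits, whatever its random choices:
every state that it can be in after some prefix of `s` takes at most `S` bits. -/
def UsesSpace (A : Algorithm Tok Out) (s : List Tok) (S : ℝ) : Prop :=
  ∀ r : List Tok, r <+: s → ∀ q ∈ (A.run r).support, ((A.enc q).length : ℝ) ≤ S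

end Algorithm

/-- `s` is a stream of the graph `G` in the adjacency list model: the vertices are revealed in an
arbitrary order `order`, and when `v` is revealed, the edges at `v` arrive one by one in an
arbitrary order, the edge `{v, w}` as the token `(v, w)`.  Every edge arrives twice, once for each
endpoint. -/
def IsAdjacencyListStream {n : ℕ} (G : SimpleGraph (Fin n)) (s : List (Fin n × Fin n)) : Prop :=
  ∃ (order : List (Fin n)) (nbrs : Fin n → List (Fin n)),
    order.Nodup ∧ (∀ v, v ∈ order) ∧
    (∀ v, (nbrs v).Nodup ∧ ∀ w, w ∈ nbrs v ↔ G.Adj v w) ∧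
    s = order.flatMap fun v => (nbrs v).map fun w => (v, w)

/-- The set `t(G)` of triangles of `G`, each as its set of three vertices. -/
def triangles {n : ℕ} (G : SimpleGraph (Fin n)) [DecidableRel G.Adj] : Finset (Finset (Fin n)) :=
  G.cliqueFinset 3

/-- The `ℓ₁`-distance of two distributions on a finite set. -/
noncomputable def l1Dist {α : Type} [Fintype α] (D₁ D₂ : PMF α) : ℝ :=
  ∑ x, |(D₁ x).toReal - (D₂ x).toReal|

/-- `out` is the output of a triangle sampler on `G`, where `none` means that the sampler
declares failure: it fails with probability at most `δ`, and when it does not fail, it reports a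
triangle of `G` from a distribution `D` on `t(G)` at `ℓ₁`-distance at most `ε` from the uniform
distribution on `t(G)`. -/
def SamplesTriangle {n : ℕ} (G : SimpleGraph (Fin n)) [DecidableRel G.Adj] (ε δ : ℝ)
    (out : PMF (Option (Finset (Fin n)))) : Prop :=
  (out none).toReal ≤ δ ∧
  ∃ (h : (triangles G).Nonempty) (D : PMF (Finset (Fin n))),
    (∀ Δ ∈ D.support, Δ ∈ triangles G) ∧
    l1Dist D (PMF.uniformOfFinset (triangles G) h) ≤ ε ∧
    ∀ Δ, out (some Δ) = (1 - out none) * D Δ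

end TriangleStream

/-! Order the vertices by their appearance in the stream and charge each triangle x < y < z to its
pair (x, y). Then z is an apex of the pair: a common neighbour revealed after y. Keeping each pair
with probability 1/Q, with Q - 1 of order at most ε²√T, needs memory for about m/Q tokens, but a
single pair may carry so many triangles that the number of triangles found is not concentrated.

Two independent token samples resolve this. When the list of y ends, the number k of common
neighbours z of x and y with (x, z) in the first sample is known, and Qk estimates the number of
common neighbours. If k ≥ K, the pair is heavy: it gets 2kQ items, and the j-th one waits for the
j-th apex and turns into that triangle if the apex arrives. If k < K, the pair is used only when (x,
y) lies in the second sample, and then each of its first 2KQ triangles yields Q items. In both cases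
a triangle within the cutoff has one item on average over the second sample. Reservoir sampling
keeps one uniformly random item, which is reported if it is a triangle. `full_vertexStream`
identifies the memory of the process with this description.

Let t be the number of triangles and fix the first sample. The number of items at heavy pairs is
then constant, and that at light pairs has variance at most (Q - 1)·2KQ·t, which is small compared
with t². So each triangle within the cutoff is reported with probability close to 1/W, where W is
the mean number of items (`sum_abs_expect_reportProb_sub_le`). By Chebyshev, on average at most 2t/K
triangles fall beyond the cutoff. The pairs have at most 3t common neighbours in total, so W
averages at most 7t and success has constant probability (`exists_sum_abs_expect_reportProb_sub_le`,
`sum_abs_div_sub_le`). Repetition lowers the failure probability without changing the conditional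
distribution (`repeated_output_some`).

The space bound holds for all random choices because exactly one position in each block of Q
positions is sampled. The positions are pairwise independent functions of a short seed
(`card_filter_sampled_pair`). -/

namespace TriangleStream

/-! ### Self-delimiting codes -/

/-- An encoding by bit strings in which a code word can be recognised as an initial segment. -/
structure PrefixCode (α : Type) where
  enc : α → List Bool
  cancel (a b : α) (s t : List Bool) : enc a ++ s = enc b ++ t → a = b ∧ s = t

namespace PrefixCode

variable {α β : Type}

theorem injective (c : PrefixCode α) : Function.Injective c.enc := fun a b h =>
  (c.cancel a b [] [] (by simpa using h)).1

/-- The code of `β` transported along an injection `α → β`. -/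
def comap (c : PrefixCode β) (f : α → β) (hf : Function.Injective f) : PrefixCode α where
  enc a := c.enc (f a)
  cancel _ _ _ _ h := ⟨hf (c.cancel _ _ _ _ h).1, (c.cancel _ _ _ _ h).2⟩

/-- One bit. -/
def bool : PrefixCode Bool where
  enc b := [b]
  cancel _ _ _ _ h := by simpa using h

/-- Concatenation of two code words. -/
def prod (c : PrefixCode α) (d : PrefixCode β) : PrefixCode (α × β) where
  enc p := c.enc p.1 ++ d.enc p.2
  cancel := by
    rintro ⟨a, a'⟩ ⟨b, b'⟩ s t h
    simp only [List.append_assoc] at h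
    obtain ⟨h1, h⟩ := c.cancel _ _ _ _ h
    obtain ⟨h2, h⟩ := d.cancel _ _ _ _ h
    exact ⟨Prod.ext h1 h2, h⟩

/-- The code words of the entries, each announced by `true`, and `false` at the end. -/
def list (c : PrefixCode α) : PrefixCode (List α) where
  enc l := (l.flatMap fun a => true :: c.enc a) ++ [false]
  cancel := by
    intro l
    induction l with
    | nil => intro l' s t h; cases l' <;> simp at h ⊢; exact h
    | cons a l ih =>
      intro l' s t h
      cases l' with
      | nil => simp at h
      | cons b l' =>
        simp only [List.flatMap_cons, List.cons_append, List.append_assoc, List.cons.injEq,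
          true_and] at h
        obtain ⟨rfl, h⟩ := c.cancel _ _ _ _ h
        have := ih l' s t (by simpa using h)
        exact ⟨by rw [this.1], this.2⟩

/-- A natural number, by its binary digits. -/
def nat : PrefixCode ℕ :=
  (list bool).comap Nat.bits fun a b h => by
    have := congrArg (fun l : List Bool => l.foldr Nat.bit 0) h
    have key : ∀ n : ℕ, (Nat.bits n).foldr Nat.bit 0 = n := by
      intro n
      induction n using Nat.binaryRec' with
      | zero => simp
      | bit b n hn ih => rw [Nat.bits_append_bit _ _ hn]; simp [ih]
    simpa [key] using this

def fin (n : ℕ) : PrefixCode (Fin n) := nat.comap Fin.val Fin.val_injective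

def option (c : PrefixCode α) : PrefixCode (Option α) :=
  c.list.comap Option.toList fun a b h => by
    cases a <;> cases b <;> simp_all

theorem length_prod (c : PrefixCode α) (d : PrefixCode β) (p : α × β) :
    ((c.prod d).enc p).length = (c.enc p.1).length + (d.enc p.2).length := by
  simp [prod]

theorem length_list_le (c : PrefixCode α) (l : List α) (B : ℕ)
    (h : ∀ a ∈ l, (c.enc a).length ≤ B) : (c.list.enc l).length ≤ l.length * (B + 1) + 1 := by
  induction l with
  | nil => simp [list]
  | cons a l ih =>
    have h1 := h a (by simp)
    have h2 := ih fun b hb => h b (by simp [hb])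
    simp only [list, List.flatMap_cons, List.length_append, List.length_cons] at h2 ⊢
    nlinarith

theorem length_list_bool (l : List Bool) : ((list bool).enc l).length = 2 * l.length + 1 := by
  induction l with
  | nil => simp [list]
  | cons a l ih => simp [list, bool] at ih ⊢; omega

theorem length_nat (x : ℕ) : (nat.enc x).length = 2 * x.size + 1 := by
  change ((list bool).enc (Nat.bits x)).length = _
  rw [length_list_bool, Nat.size_eq_bits_len]

theorem length_nat_le {x b : ℕ} (h : x < 2 ^ b) : (nat.enc x).length ≤ 2 * b + 1 := by
  have := Nat.size_le.2 h
  rw [length_nat]; omega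

theorem length_fin_le {n : ℕ} (x : Fin n) {b : ℕ} (h : n ≤ 2 ^ b) :
    ((fin n).enc x).length ≤ 2 * b + 1 :=
  length_nat_le (x.2.trans_le h)

theorem length_option_le (c : PrefixCode α) (o : Option α) (B : ℕ)
    (h : ∀ a, o = some a → (c.enc a).length ≤ B) : (c.option.enc o).length ≤ B + 2 := by
  cases o with
  | none => simp [option, comap, list]
  | some a => have := h a rfl; simp [option, comap, list]; omega

end PrefixCode

/-! ### Independent repetition -/

namespace Algorithm

variable {Tok O : Type}

theorem run_concat {Out : Type} (A : Algorithm Tok Out) (s : List Tok) (t : Tok) :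
    A.run (s ++ [t]) = (A.run s).bind fun q => A.step q t := by
  simp [run]

/-- Run `A` and `B` side by side with independent randomness, and report the output of `A`, or
the output of `B` if `A` fails. -/
noncomputable def orElse (A B : Algorithm Tok (Option O)) : Algorithm Tok (Option O) where
  State := A.State × B.State
  -- Making the first code self-delimiting doubles its length and adds one bit.
  enc q := (PrefixCode.list PrefixCode.bool).enc (A.enc q.1) ++ B.enc q.2
  enc_injective := by
    rintro ⟨a, b⟩ ⟨a', b'⟩ h
    obtain ⟨h1, h2⟩ := PrefixCode.cancel _ _ _ _ _ h
    exact Prod.ext (A.enc_injective h1) (B.enc_injective h2)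
  init := A.init.bind fun a => B.init.map (Prod.mk a)
  step q t := (A.step q.1 t).bind fun a => (B.step q.2 t).map (Prod.mk a)
  report q := (A.report q.1).bind fun o =>
    match o with
    | some x => PMF.pure (some x)
    | none => B.report q.2

/-- The algorithm that always fails. -/
noncomputable def failing (Tok O : Type) : Algorithm Tok (Option O) where
  State := Unit
  enc _ := []
  enc_injective _ _ _ := rfl
  init := PMF.pure ()
  step _ _ := PMF.pure ()
  report _ := PMF.pure none

/-- The first success among `k` independent copies of `A`. -/
noncomputable def repeated (A : Algorithm Tok (Option O)) : ℕ → Algorithm Tok (Option O)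
  | 0 => failing Tok O
  | k + 1 => A.orElse (A.repeated k)

/-- The copies use separate randomness, so the joint law remains a product; two independent draws
only have to be exchanged. -/
theorem orElse_run (A B : Algorithm Tok (Option O)) (s : List Tok) :
    (A.orElse B).run s = (A.run s).bind fun a => (B.run s).map (Prod.mk a) := by
  induction s using List.reverseRecOn with
  | nil => rfl
  | append_singleton s t ih =>
    rw [run_concat, ih, run_concat, run_concat]
    simp only [orElse, PMF.bind_bind, PMF.bind_map, PMF.map_bind, Function.comp_def]
    congr 1
    funext a
    rw [PMF.bind_comm]

theorem orElse_output (A B : Algorithm Tok (Option O)) (s : List Tok) :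
    (A.orElse B).output s = (A.output s).bind fun o =>
      match o with
      | some x => PMF.pure (some x)
      | none => B.output s := by
  rw [output, orElse_run]
  have key : ∀ a : A.State, (((B.run s).map (Prod.mk a)).bind fun q =>
      (A.orElse B).report q) = (A.report a).bind fun o =>
        match o with
        | some x => PMF.pure (some x)
        | none => B.output s := by
    intro a
    rw [PMF.bind_map]
    change ((B.run s).bind fun b => (A.report a).bind fun o => _) = _
    rw [PMF.bind_comm]
    congr 1
    funext o
    cases o with
    | none => rfl
    | some x => simp
  rw [output, PMF.bind_bind, ← funext key]
  exact PMF.bind_bind _ _ _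

theorem orElse_output_none (A B : Algorithm Tok (Option O)) (s : List Tok) :
    (A.orElse B).output s none = A.output s none * B.output s none := by
  rw [orElse_output, PMF.bind_apply, tsum_eq_single none]
  rintro (_ | x) h
  · exact absurd rfl h
  · simp

theorem orElse_output_some (A B : Algorithm Tok (Option O)) (s : List Tok) (x : O) :
    (A.orElse B).output s (some x) =
      A.output s (some x) + A.output s none * B.output s (some x) := by
  classical
  rw [orElse_output, PMF.bind_apply, ENNReal.tsum_eq_add_tsum_ite none, add_comm]
  congr 1
  rw [tsum_eq_single (some x)]
  · simp
  · rintro (_ | y) h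
    · simp
    · have : x ≠ y := by rintro rfl; exact h rfl
      simp [this]

theorem repeated_output_none (A : Algorithm Tok (Option O)) (s : List Tok) (k : ℕ) :
    (A.repeated k).output s none = A.output s none ^ k := by
  induction k with
  | zero => simp [repeated, failing, output]
  | succ k ih => rw [repeated, orElse_output_none, ih, pow_succ']

/-- Retrying does not bias the result: with failure probabilities a and b the success mass is (1 -
a) + a(1 - b) = 1 - ab, and both summands are distributed as `D`. -/
theorem repeated_output_some (A : Algorithm Tok (Option O)) (s : List Tok) (D : PMF O)
    (h : ∀ x, A.output s (some x) = (1 - A.output s none) * D x) (k : ℕ) (x : O) :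
    (A.repeated k).output s (some x) = (1 - (A.repeated k).output s none) * D x := by
  induction k with
  | zero => simp [repeated, failing, output]
  | succ k ih =>
    have hA := (A.output s).coe_le_one none
    have hB := ((A.repeated k).output s).coe_le_one none
    rw [repeated, orElse_output_some, orElse_output_none, ih, h, ← mul_assoc, ← add_mul]
    congr 1
    rw [ENNReal.mul_sub (fun _ _ => PMF.apply_ne_top _ _), mul_one]
    exact tsub_add_tsub_cancel hA (mul_le_of_le_one_right' hB)

theorem orElse_usesSpace {A B : Algorithm Tok (Option O)} {s : List Tok} {S S' : ℝ}
    (hA : A.UsesSpace s S) (hB : B.UsesSpace s S') :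
    (A.orElse B).UsesSpace s (2 * S + 1 + S') := by
  intro r hr q hq
  rw [orElse_run] at hq
  obtain ⟨a, ha, hq⟩ := (PMF.mem_support_bind_iff _ _ _).1 hq
  obtain ⟨b, hb, rfl⟩ := (PMF.mem_support_map_iff _ _ _).1 hq
  have h1 := hA r hr a ha
  have h2 := hB r hr b hb
  change ((((PrefixCode.list PrefixCode.bool).enc (A.enc a) ++ B.enc b).length : ℕ) : ℝ) ≤ _
  rw [List.length_append, PrefixCode.length_list_bool]
  push_cast
  linarith

theorem repeated_usesSpace {A : Algorithm Tok (Option O)} {s : List Tok} {S : ℝ}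
    (hA : A.UsesSpace s S) (k : ℕ) : (A.repeated k).UsesSpace s (k * (2 * S + 1)) := by
  induction k with
  | zero => intro r hr q hq; simp [repeated, failing]
  | succ k ih =>
    have := orElse_usesSpace hA ih
    rw [repeated]
    convert this using 1
    push_cast; ring

end Algorithm

end TriangleStream


namespace TriangleStream

/-! ### Pairwise independent sampling of one position in each block of length `Q` -/

/-- The random bits that determine which positions of the stream are sampled. -/
abbrev Seed (Q l : ℕ) : Type := ZMod Q × (Fin l → ZMod Q)

namespace Seed

variable {Q l : ℕ}

/-- The position sampled in block `b`. -/
def offset (σ : Seed Q l) (b : ℕ) : ZMod Q := σ.1 + ∑ i : Fin l, if b.testBit i then σ.2 i else 0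

/-- Whether position `i` of the stream is sampled. -/
def sampled (σ : Seed Q l) (i : ℕ) : Bool := decide ((i : ZMod Q) = σ.offset (i / Q))

theorem sampled_iff (σ : Seed Q l) (i : ℕ) : σ.sampled i ↔ (i : ZMod Q) = σ.offset (i / Q) := by
  simp [sampled]

theorem eq_of_sampled_of_div_eq {σ : Seed Q l} {i j : ℕ} (hi : σ.sampled i) (hj : σ.sampled j)
    (h : i / Q = j / Q) : i = j := by
  rw [sampled_iff] at hi hj
  rw [h, ← hj, ZMod.natCast_eq_natCast_iff] at hi
  rw [← Nat.div_add_mod i Q, ← Nat.div_add_mod j Q, h, hi]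

/-- One sample per block at most, for every seed: this is what makes the space bound deterministic.
-/
theorem card_sampled_le (σ : Seed Q l) (N : ℕ) :
    ((Finset.range N).filter fun i => σ.sampled i).card ≤ N / Q + 1 := by
  rw [← Finset.card_range (N / Q + 1)]
  refine Finset.card_le_card_of_injOn (· / Q) ?_ ?_
  · intro i hi
    simp only [Finset.coe_filter, Finset.mem_range, Set.mem_ofPred_eq, Finset.coe_range,
      Set.mem_Iio] at hi ⊢
    exact Nat.lt_succ_of_le (Nat.div_le_div_right hi.1.le)
  · intro i hi j hj h
    simp only [Finset.coe_filter, Finset.mem_range, Set.mem_ofPred_eq] at hi hj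
    exact eq_of_sampled_of_div_eq hi.2 hj.2 h

theorem offset_shift (σ : Seed Q l) (b : ℕ) (u v : ZMod Q) (k : Fin l) :
    offset ((σ.1 + u, σ.2 + Pi.single k v) : Seed Q l) b
      = σ.offset b + u + if b.testBit k then v else 0 := by
  have : (∑ i : Fin l, if b.testBit i then (σ.2 + Pi.single k v : Fin l → ZMod Q) i else 0)
      = (∑ i : Fin l, if b.testBit i then σ.2 i else 0)
        + ∑ i : Fin l, if i = k then (if b.testBit k then v else 0) else 0 := by
    rw [← Finset.sum_add_distrib]
    refine Finset.sum_congr rfl fun i _ => ?_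
    by_cases h : i = k
    · subst h; by_cases h' : b.testBit i <;> simp [h']
    · by_cases h' : b.testBit i <;> simp [h, h']
  simp only [offset, this, Finset.sum_ite_eq', Finset.mem_univ, if_true]
  ring

variable [NeZero Q]

theorem card_filter_sampled (i : ℕ) :
    Q * (Finset.univ.filter fun σ : Seed Q l => σ.sampled i).card = Fintype.card (Seed Q l) := by
  have : (Finset.univ.filter fun σ : Seed Q l => σ.sampled i).card
      = (Finset.univ : Finset (Fin l → ZMod Q)).card := by
    refine Finset.card_bij' (fun σ _ => σ.2)
      (fun a _ => ((i : ZMod Q) - ∑ j : Fin l, if (i / Q).testBit j then a j else 0, a))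
      (by simp) ?_ ?_ (by simp)
    · intro a _
      simp [sampled_iff, offset]
    · intro σ hσ
      rw [Finset.mem_filter, sampled_iff, offset] at hσ
      ext1
      · rw [hσ.2]; simp
      · rfl
  rw [this, Fintype.card_prod, ZMod.card, Finset.card_univ]

/-- Within one block two positions are never sampled together. Indices of different blocks differ in
some bit k < l, and a shift of the seed by u globally and by v in coordinate k can be recovered from
its effect on the two offsets. So the Q² shifts of the seeds sampling both positions are all
distinct. No primality of `Q` is needed. -/
theorem card_filter_sampled_pair {i j : ℕ} (hij : i ≠ j) (hi : i < 2 ^ l) (hj : j < 2 ^ l) :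
    Q ^ 2 * (Finset.univ.filter fun σ : Seed Q l => σ.sampled i ∧ σ.sampled j).card
      ≤ Fintype.card (Seed Q l) := by
  by_cases hb : i / Q = j / Q
  · have : (Finset.univ.filter fun σ : Seed Q l => σ.sampled i ∧ σ.sampled j) = ∅ := by
      refine Finset.filter_eq_empty_iff.2 fun σ _ h => hij ?_
      exact eq_of_sampled_of_div_eq h.1 h.2 hb
    simp [this]
  obtain ⟨k, hk⟩ := Nat.exists_testBit_ne_of_ne hb
  have hkl : k < l := by
    by_contra hkl
    have hpow : 2 ^ l ≤ 2 ^ k := Nat.pow_le_pow_right (by norm_num) (by omega)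
    rw [Nat.testBit_lt_two_pow ((Nat.div_le_self _ _).trans_lt (hi.trans_le hpow)),
      Nat.testBit_lt_two_pow ((Nat.div_le_self _ _).trans_lt (hj.trans_le hpow))] at hk
    exact hk rfl
  have hcard : Q ^ 2 = (Finset.univ : Finset (ZMod Q × ZMod Q)).card := by
    rw [Finset.card_univ, Fintype.card_prod, ZMod.card, sq]
  rw [hcard, mul_comm, ← Finset.card_product, ← Finset.card_univ]
  refine Finset.card_le_card_of_injOn
    (fun p => ((p.1.1 + p.2.1, p.1.2 + Pi.single ⟨k, hkl⟩ p.2.2) : Seed Q l))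
    (fun _ _ => Finset.mem_coe.2 (Finset.mem_univ _)) ?_
  rintro ⟨σ, u, v⟩ h ⟨σ', u', v'⟩ h' heq
  simp only [Finset.coe_product, Set.mem_prod, Finset.mem_coe, Finset.mem_filter,
    Finset.mem_univ, true_and, and_true, sampled_iff] at h h'
  have e1 := congrArg (fun τ : Seed Q l => τ.offset (i / Q)) heq
  have e2 := congrArg (fun τ : Seed Q l => τ.offset (j / Q)) heq
  simp only [offset_shift, ← h.1, ← h.2, ← h'.1, ← h'.2] at e1 e2
  -- The block whose index lacks bit k determines u, and the other one then determines v.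
  have huv : u = u' ∧ v = v' := by
    rcases Bool.eq_false_or_eq_true ((i / Q).testBit k) with hik | hik <;>
    rcases Bool.eq_false_or_eq_true ((j / Q).testBit k) with hjk | hjk <;>
    simp_all
  obtain ⟨rfl, rfl⟩ := huv
  simp only [Prod.mk.injEq, add_left_inj] at heq
  rw [Prod.ext heq.1 heq.2]

open BigOperators in
theorem expect_sampled (i : ℕ) :
    𝔼 σ : Seed Q l, (if σ.sampled i then (1 : ℝ) else 0) = 1 / Q := by
  have h := card_filter_sampled (Q := Q) (l := l) i
  have hQ : (Q : ℝ) ≠ 0 := Nat.cast_ne_zero.2 (NeZero.ne Q)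
  have hc : (Fintype.card (Seed Q l) : ℝ) ≠ 0 := Nat.cast_ne_zero.2 Fintype.card_ne_zero
  rw [Fintype.expect_eq_sum_div_card, Finset.sum_boole, div_eq_div_iff hc hQ, one_mul]
  rw [← h]; push_cast; ring

open BigOperators in
theorem expect_sampled_pair_le {i j : ℕ} (hij : i ≠ j) (hi : i < 2 ^ l) (hj : j < 2 ^ l) :
    𝔼 σ : Seed Q l, ((if σ.sampled i then (1 : ℝ) else 0) * (if σ.sampled j then 1 else 0))
      ≤ 1 / (Q : ℝ) ^ 2 := by
  have h := card_filter_sampled_pair (Q := Q) hij hi hj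
  have hQ : (0 : ℝ) < Q := Nat.cast_pos.2 (NeZero.pos Q)
  have hc : (0 : ℝ) < Fintype.card (Seed Q l) := Nat.cast_pos.2 Fintype.card_pos
  have : ∀ σ : Seed Q l, ((if σ.sampled i then (1 : ℝ) else 0) * (if σ.sampled j then 1 else 0))
      = if σ.sampled i ∧ σ.sampled j then 1 else 0 := by
    intro σ
    by_cases h1 : σ.sampled i <;> by_cases h2 : σ.sampled j <;> simp [h1, h2]
  simp_rw [this]
  rw [Fintype.expect_eq_sum_div_card, Finset.sum_boole, div_le_div_iff₀ hc (by positivity), one_mul,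
    mul_comm]
  exact_mod_cast h

end Seed

end TriangleStream


namespace TriangleStream

/-! ### Reservoir sampling -/

section Reservoir

variable {Tok Core Item Out S : Type}

open Classical in
/-- A uniformly random entry of a list, and `none` if the list is empty. -/
noncomputable def uniformEntry (M : List (Option Item)) : PMF (Option Item) :=
  if h : (M : Multiset (Option Item)) = 0 then PMF.pure none else PMF.ofMultiset M h

theorem uniformEntry_apply [BEq (Option Item)] [LawfulBEq (Option Item)] {M : List (Option Item)} (hM : M ≠ []) (o : Option Item) :
    uniformEntry M o = M.count o / M.length := by
  rw [uniformEntry, dif_neg (by simpa using hM), PMF.ofMultiset_apply]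
  simp only [Multiset.coe_count, Multiset.coe_card]
  congr 3
  exact lawful_beq_subsingleton _ _

@[simp]
theorem uniformEntry_nil : uniformEntry ([] : List (Option Item)) = PMF.pure none := by
  simp [uniformEntry]

theorem mem_support_uniformEntry {M : List (Option Item)} {o : Option Item}
    (h : o ∈ (uniformEntry M).support) : o = none ∨ o ∈ M := by
  classical
  by_cases hM : M = []
  · subst hM; left; simpa using h
  · right
    rw [PMF.mem_support_iff, uniformEntry_apply hM] at h
    by_contra h'
    exact h (by simp [List.count_eq_zero_of_not_mem h'])

theorem tsum_count_mul [BEq Item] [LawfulBEq Item] (L : List Item) (f : Item → ENNReal) :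
    ∑' x, (L.count x : ENNReal) * f x = (L.map f).sum := by
  induction L with
  | nil => simp
  | cons a L ih =>
    classical
    simp only [List.count_cons, beq_iff_eq, List.map_cons, List.sum_cons, Nat.cast_add, add_mul]
    rw [ENNReal.tsum_add, ih, add_comm]
    congr 1
    rw [tsum_eq_single a]
    · simp
    · intro b hb; simp [hb.symm]

theorem uniformEntry_bind_apply {L : List Item} (hL : L ≠ []) {β : Type}
    (f : Option Item → PMF β) (x : β) :
    (uniformEntry (L.map some)).bind f x = (L.map fun i => f (some i) x).sum / L.length := by
  classical
  rw [PMF.bind_apply]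
  have : ∀ o, uniformEntry (L.map some) o * f o x
      = ((L.length : ENNReal))⁻¹ * (((L.map some).count o : ENNReal) * f o x) := by
    intro o
    rw [uniformEntry_apply (by simpa using hL), List.length_map, ENNReal.div_eq_inv_mul, mul_assoc]
  simp_rw [this]
  rw [ENNReal.tsum_mul_left, tsum_count_mul, ENNReal.div_eq_inv_mul, List.map_map]
  rfl

/-- Adding the entries of `B` to a population of which one uniformly random member is known. -/
theorem uniformEntry_extend (L B : List Item) (f : Item → Item) :
    ((uniformEntry (L.map some)).bind fun o =>
      uniformEntry (List.replicate L.length (o.map f) ++ B.map some))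
      = uniformEntry ((L.map f ++ B).map some) := by
  classical
  by_cases hL : L = []
  · subst hL; simp
  ext x
  have hl : (L.length : ENNReal) ≠ 0 := by simpa using hL
  rw [uniformEntry_bind_apply hL, uniformEntry_apply (by simp [hL])]
  have : ∀ i : Item, uniformEntry (List.replicate L.length (Option.map f (some i)) ++ B.map some) x
      = ((L.length : ENNReal) * (if some (f i) = x then 1 else 0) + (B.map some).count x)
        / (L.length + B.length : ℕ) := by
    intro i
    rw [uniformEntry_apply (by simp [hL])]
    simp [List.count_append, List.count_replicate]
  simp_rw [this]
  have hsum : ∀ L' : List Item, (L'.map fun i =>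
      ((L.length : ENNReal) * (if some (f i) = x then 1 else 0) + (B.map some).count x)
        / (L.length + B.length : ℕ)).sum
      = ((L.length : ENNReal) * ((L'.map f).map some).count x
          + L'.length * (B.map some).count x) / (L.length + B.length : ℕ) := by
    intro L'
    induction L' with
    | nil => simp
    | cons a L' ih =>
      rw [List.map_cons, List.sum_cons, ih, ← ENNReal.add_div]
      congr 1
      simp only [List.map_cons, List.count_cons, List.length_cons, beq_iff_eq]
      push_cast
      ring
  rw [hsum, ← mul_add, ← Nat.cast_add, ← List.count_append, ← List.map_append, mul_div_assoc,
    mul_comm, ENNReal.mul_div_cancel_right hl (ENNReal.natCast_ne_top _)]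
  simp

/-- A deterministic streaming process with state in `Core` that produces items.  An item evolves
as the stream goes on, and has an output when the stream has ended. -/
structure ItemProcess (Tok Core Item Out : Type) where
  init : Core
  update : Core → Tok → Core
  evolve : Core → Tok → Item → Item
  new : Core → Tok → List Item
  finalEvolve : Core → Item → Item
  finalNew : Core → List Item
  out : Item → Option Out

namespace ItemProcess

/-- One step of the process, with the list of all items produced so far. -/
def fullStep (P : ItemProcess Tok Core Item Out) (q : Core × List Item) (t : Tok) :
    Core × List Item :=
  (P.update q.1 t, q.2.map (P.evolve q.1 t) ++ P.new q.1 t)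

def full (P : ItemProcess Tok Core Item Out) (s : List Tok) : Core × List Item :=
  s.foldl P.fullStep (P.init, [])

/-- All items at the end of the stream. -/
def items (P : ItemProcess Tok Core Item Out) (s : List Tok) : List Item :=
  (P.full s).2.map (P.finalEvolve (P.full s).1) ++ P.finalNew (P.full s).1

theorem full_concat (P : ItemProcess Tok Core Item Out) (s : List Tok) (t : Tok) :
    P.full (s ++ [t]) = P.fullStep (P.full s) t := by
  simp [full]

/-- The algorithm that draws a seed and then keeps one uniformly random item of the process with
that seed. -/
noncomputable def sampler [Fintype S] [Nonempty S] (P : S → ItemProcess Tok Core Item Out)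
    (enc : PrefixCode (S × Core × ℕ × Option Item)) : Algorithm Tok (Option Out) where
  State := S × Core × ℕ × Option Item
  enc := enc.enc
  enc_injective := enc.injective
  init := (PMF.uniformOfFintype S).map fun σ => (σ, (P σ).init, 0, none)
  step q t :=
    (uniformEntry (List.replicate q.2.2.1 (q.2.2.2.map ((P q.1).evolve q.2.1 t))
      ++ ((P q.1).new q.2.1 t).map some)).map fun o =>
        (q.1, (P q.1).update q.2.1 t, q.2.2.1 + ((P q.1).new q.2.1 t).length, o)
  report q :=
    (uniformEntry (List.replicate q.2.2.1 (q.2.2.2.map ((P q.1).finalEvolve q.2.1))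
      ++ ((P q.1).finalNew q.2.1).map some)).map fun o => o.bind (P q.1).out

variable [Fintype S] [Nonempty S] (P : S → ItemProcess Tok Core Item Out)
  (enc : PrefixCode (S × Core × ℕ × Option Item))

/-- Items evolve independently of which one is kept, so given the seed the full list of items is
deterministic and the memory holds a uniform entry of it. -/
theorem sampler_run (s : List Tok) :
    (sampler P enc).run s = (PMF.uniformOfFintype S).bind fun σ =>
      (uniformEntry (((P σ).full s).2.map some)).map fun o =>
        (σ, ((P σ).full s).1, ((P σ).full s).2.length, o) := by
  induction s using List.reverseRecOn with
  | nil =>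
    change (PMF.uniformOfFintype S).map _ = _
    simp [full, ← PMF.bind_pure_comp, Function.comp_def]
  | append_singleton s t ih =>
    rw [Algorithm.run_concat, ih]
    refine (PMF.bind_bind _ _ _).trans ?_
    congr 1
    funext σ
    refine (PMF.bind_map _ _ _).trans ?_
    rw [full_concat]
    simp only [fullStep]
    rw [← uniformEntry_extend, PMF.map_bind]
    congr 1
    funext o
    simp [sampler]

theorem sampler_output (s : List Tok) :
    (sampler P enc).output s = (PMF.uniformOfFintype S).bind fun σ =>
      (uniformEntry (((P σ).items s).map some)).map fun o => o.bind (P σ).out := by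
  rw [Algorithm.output, sampler_run]
  refine (PMF.bind_bind _ _ _).trans ?_
  congr 1
  funext σ
  refine (PMF.bind_map _ _ _).trans ?_
  rw [items, ← uniformEntry_extend, PMF.map_bind]
  rfl

open BigOperators in
theorem sampler_output_some (s : List Tok) (x : Out) (p : S → Item → Bool)
    (hp : ∀ σ i, p σ i = true ↔ (P σ).out i = some x) :
    ((sampler P enc).output s (some x)).toReal
      = 𝔼 σ : S, (((P σ).items s).countP (p σ) : ℝ) / ((P σ).items s).length := by
  classical
  rw [sampler_output, PMF.bind_apply, tsum_fintype]
  simp only [PMF.uniformOfFintype_apply]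
  rw [← Finset.mul_sum, Fintype.expect_eq_sum_div_card, ENNReal.toReal_mul, ENNReal.toReal_inv,
    ENNReal.toReal_natCast, ← div_eq_inv_mul, ENNReal.toReal_sum (fun _ _ => PMF.apply_ne_top _ _)]
  congr 1
  refine Finset.sum_congr rfl fun σ _ => ?_
  -- Without items the report is `none`, and the quotient is 0 / 0 = 0.
  by_cases hL : (P σ).items s = []
  · simp [hL, PMF.pure_map]
  rw [← PMF.bind_pure_comp, uniformEntry_bind_apply hL, ENNReal.toReal_div]
  simp only [ENNReal.toReal_natCast]
  congr 1
  generalize (P σ).items s = L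
  have : (L.map fun i => (PMF.pure ∘ fun o : Option Item => o.bind (P σ).out) (some i) (some x)).sum
      = ((L.countP (p σ) : ℕ) : ENNReal) := by
    induction L with
    | nil => simp
    | cons a L ih =>
      rw [List.map_cons, List.sum_cons, ih, List.countP_cons]
      by_cases h : (P σ).out a = some x
      · simp [h, (hp σ a).2 h, add_comm]
      · simp [Ne.symm h, mt (hp σ a).1 h]
  rw [this, ENNReal.toReal_natCast]

theorem sampler_usesSpace (s : List Tok) (B : ℝ)
    (h : ∀ r, r <+: s → ∀ σ, ∀ o, (o = none ∨ ∃ i ∈ ((P σ).full r).2, o = some i) →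
      ((enc.enc (σ, ((P σ).full r).1, ((P σ).full r).2.length, o)).length : ℝ) ≤ B) :
    (sampler P enc).UsesSpace s B := by
  intro r hr q hq
  rw [sampler_run] at hq
  obtain ⟨σ, _, hq⟩ := (PMF.mem_support_bind_iff _ _ _).1 hq
  obtain ⟨o, ho, rfl⟩ := (PMF.mem_support_map_iff _ _ _).1 hq
  refine h r hr σ o ?_
  rcases mem_support_uniformEntry ho with h | h
  · exact Or.inl h
  · obtain ⟨i, hi, rfl⟩ := List.mem_map.1 h
    exact Or.inr ⟨i, hi, rfl⟩

end ItemProcess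

end Reservoir

end TriangleStream


namespace TriangleStream

/-! ### The triangle process -/

/-- A pair of vertices, with flags telling which of them have been seen in the list of the current
vertex, and a counter. -/
structure Entry (V : Type) where
  fst : V
  snd : V
  seenFst : Bool
  seenSnd : Bool
  cnt : ℕ

/-- A candidate for the reported triangle: a pair together with the number of common neighbours to
be skipped, or a triangle. -/
inductive Item (V : Type) where
  | watch (e : Entry V)
  | tri (x y z : V)

variable {V : Type} [DecidableEq V]

namespace Entry

def new (v w : V) (k : ℕ) : Entry V := ⟨v, w, false, false, k⟩

def hit (e : Entry V) : Bool := e.seenFst && e.seenSnd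

def clear (e : Entry V) : Entry V := new e.fst e.snd e.cnt

def touch (e : Entry V) (w : V) : Entry V :=
  ⟨e.fst, e.snd, e.seenFst || decide (e.fst = w), e.seenSnd || decide (e.snd = w), e.cnt⟩

theorem foldl_touch (nb : List V) (e : Entry V) :
    nb.foldl touch e = ⟨e.fst, e.snd, e.seenFst || decide (e.fst ∈ nb),
      e.seenSnd || decide (e.snd ∈ nb), e.cnt⟩ := by
  induction nb generalizing e with
  | nil => simp
  | cons w nb ih => simp [ih, touch, Bool.or_assoc]

end Entry

namespace Item

def touch : Item V → V → Item V
  | watch e, w => watch (e.touch w)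
  | tri x y z, _ => tri x y z

theorem foldl_touch_watch (nb : List V) (e : Entry V) :
    nb.foldl touch (watch e) = watch (nb.foldl Entry.touch e) := by
  induction nb generalizing e with
  | nil => rfl
  | cons w nb ih => simp [ih, touch]

theorem foldl_touch_tri (nb : List V) (x y z : V) : nb.foldl touch (tri x y z) = tri x y z := by
  induction nb with
  | nil => rfl
  | cons w nb ih => simpa [touch] using ih

/-- The effect on an item of the end of the list of `v`. -/
def finish (v : V) : Item V → Item V
  | watch e => if e.hit then
      (if e.cnt = 0 then tri e.fst e.snd v else watch (Entry.new e.fst e.snd (e.cnt - 1)))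
      else watch e.clear
  | tri x y z => tri x y z

def out : Item V → Option (Finset V)
  | watch _ => none
  | tri x y z => some {x, y, z}

end Item

/-- The deterministic part of the memory: the current vertex, the number of tokens read, and the
two samples of tokens. -/
structure Core (V : Type) where
  cur : Option V
  time : ℕ
  S₁ : List (Entry V)
  S₂ : List (Entry V)

/-- The number of pairs `(x, _)` in the sample `l` both of whose vertices have been seen. -/
def hits (l : List (Entry V)) (x : V) : ℕ := l.countP fun e => e.hit && decide (e.fst = x)

/-- The effect on an entry of the second sample of the end of the list of `v`.  A positive counter
exceeds by one the number of triangles found with this pair. -/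
def advance (K : ℕ) (l : List (Entry V)) (v : V) (e : Entry V) : Entry V :=
  Entry.new e.fst e.snd
    (if e.snd = v then (if hits l e.fst < K then 1 else e.cnt)
     else if e.hit ∧ 0 < e.cnt then e.cnt + 1 else e.cnt)

namespace Core

def finish (K : ℕ) (c : Core V) : Core V :=
  match c.cur with
  | none => c
  | some v => ⟨none, c.time, c.S₁.map Entry.clear, c.S₂.map (advance K c.S₁ v)⟩

def finishItem (c : Core V) (i : Item V) : Item V :=
  match c.cur with
  | none => i
  | some v => i.finish v

/-- Item j waits for apex number j. The number of items is twice the estimate of the number of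
common neighbours, so that usually every apex is awaited; surplus items remain watches and lead to
failure. -/
def heavyItems (Q K : ℕ) (l : List (Entry V)) (v x : V) : List (Item V) :=
  if K ≤ hits l x then
    (List.range (2 * hits l x * Q)).map fun j => Item.watch (Entry.new x v j)
  else []

/-- A positive `e.cnt` is one more than the number of earlier apexes, so the condition selects the
first 2KQ of them. The value 0 marks a pair that is heavy or whose second vertex has not been
revealed after the first. The Q copies compensate the sampling probability 1/Q. -/
def lightItems (Q K : ℕ) (v : V) (e : Entry V) : List (Item V) :=
  if e.hit ∧ 1 ≤ e.cnt ∧ e.cnt ≤ 2 * K * Q then List.replicate Q (Item.tri e.fst e.snd v) else []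

/-- The items that are produced at the end of the list of the current vertex. -/
def batch {n : ℕ} (Q K : ℕ) (c : Core (Fin n)) : List (Item (Fin n)) :=
  match c.cur with
  | none => []
  | some v => (List.finRange n).flatMap (heavyItems Q K c.S₁ v) ++ c.S₂.flatMap (lightItems Q K v)

def read (s₁ s₂ : ℕ → Bool) (c : Core V) (t : V × V) : Core V :=
  ⟨some t.1, c.time + 1,
    c.S₁.map (Entry.touch · t.2) ++ if s₁ c.time then [Entry.new t.1 t.2 0] else [],
    c.S₂.map (Entry.touch · t.2) ++ if s₂ c.time then [Entry.new t.1 t.2 0] else []⟩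

end Core

variable {n : ℕ}

/-- The process behind the triangle sampler, where position `i` of the stream belongs to the first
(second) sample of tokens if `s₁ i` (`s₂ i`). -/
def triangleProcess (n Q K : ℕ) (s₁ s₂ : ℕ → Bool) :
    ItemProcess (Fin n × Fin n) (Core (Fin n)) (Item (Fin n)) (Finset (Fin n)) where
  init := ⟨none, 0, [], []⟩
  -- The end of a list is noticed only when a token of another vertex arrives; the last list is
  -- closed by `finalEvolve` and `finalNew`.
  update c t := (if c.cur = some t.1 then c else c.finish K).read s₁ s₂ t
  evolve c t i := (if c.cur = some t.1 then i else c.finishItem i).touch t.2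
  new c t := if c.cur = some t.1 then [] else (c.batch Q K).map (Item.touch · t.2)
  finalEvolve c := c.finishItem
  finalNew c := c.batch Q K
  out := Item.out

def finishAll (Q K : ℕ) (q : Core (Fin n) × List (Item (Fin n))) :
    Core (Fin n) × List (Item (Fin n)) :=
  (q.1.finish K, q.2.map q.1.finishItem ++ q.1.batch Q K)

def readAll (s₁ s₂ : ℕ → Bool) (q : Core (Fin n) × List (Item (Fin n))) (t : Fin n × Fin n) :
    Core (Fin n) × List (Item (Fin n)) :=
  (q.1.read s₁ s₂ t, q.2.map (Item.touch · t.2))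

/-! ### Processing the list of one vertex as a block -/

section

variable {Q K : ℕ} {s₁ s₂ : ℕ → Bool}

theorem fullStep_of_cur_eq {q : Core (Fin n) × List (Item (Fin n))} {t : Fin n × Fin n}
    (h : q.1.cur = some t.1) :
    (triangleProcess n Q K s₁ s₂).fullStep q t = readAll s₁ s₂ q t := by
  simp [ItemProcess.fullStep, triangleProcess, readAll, h]

theorem fullStep_of_cur_ne {q : Core (Fin n) × List (Item (Fin n))} {t : Fin n × Fin n}
    (h : q.1.cur ≠ some t.1) :
    (triangleProcess n Q K s₁ s₂).fullStep q t = readAll s₁ s₂ (finishAll Q K q) t := by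
  simp [ItemProcess.fullStep, triangleProcess, readAll, finishAll, h]

theorem foldl_fullStep_of_cur_eq {q : Core (Fin n) × List (Item (Fin n))} {v : Fin n}
    (h : q.1.cur = some v) (nb : List (Fin n)) :
    (nb.map (Prod.mk v)).foldl (triangleProcess n Q K s₁ s₂).fullStep q
      = (nb.map (Prod.mk v)).foldl (readAll s₁ s₂) q := by
  induction nb generalizing q with
  | nil => rfl
  | cons w nb ih =>
    simp only [List.map_cons, List.foldl_cons]
    rw [fullStep_of_cur_eq h, ih]
    rfl

theorem foldl_fullStep_of_cur_ne {q : Core (Fin n) × List (Item (Fin n))} {v : Fin n}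
    (h : q.1.cur ≠ some v) {nb : List (Fin n)} (hnb : nb ≠ []) :
    (nb.map (Prod.mk v)).foldl (triangleProcess n Q K s₁ s₂).fullStep q
      = (nb.map (Prod.mk v)).foldl (readAll s₁ s₂) (finishAll Q K q) := by
  cases nb with
  | nil => exact absurd rfl hnb
  | cons w nb =>
    simp only [List.map_cons, List.foldl_cons]
    rw [fullStep_of_cur_ne h, foldl_fullStep_of_cur_eq rfl]

theorem items_eq (s : List (Fin n × Fin n)) :
    (triangleProcess n Q K s₁ s₂).items s
      = (finishAll Q K ((triangleProcess n Q K s₁ s₂).full s)).2 := rfl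

/-- The entries that are added to a sample while the list of `v` is read. -/
def fresh (s : ℕ → Bool) (v : V) : List V → ℕ → List (Entry V)
  | [], _ => []
  | w :: nb, t => (if s t then [nb.foldl Entry.touch (Entry.new v w 0)] else []) ++
      fresh s v nb (t + 1)

theorem foldl_readAll (v : Fin n) (nb : List (Fin n)) (hnb : nb ≠ [])
    (q : Core (Fin n) × List (Item (Fin n))) :
    (nb.map (Prod.mk v)).foldl (readAll s₁ s₂) q
      = (⟨some v, q.1.time + nb.length,
          q.1.S₁.map (nb.foldl Entry.touch) ++ fresh s₁ v nb q.1.time,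
          q.1.S₂.map (nb.foldl Entry.touch) ++ fresh s₂ v nb q.1.time⟩,
         q.2.map (nb.foldl Item.touch)) := by
  induction nb generalizing q with
  | nil => exact absurd rfl hnb
  | cons w nb ih =>
    by_cases h : nb = []
    · subst h
      simp [readAll, Core.read, fresh]
    · rw [List.map_cons, List.foldl_cons, ih h]
      simp only [readAll, Core.read, fresh, List.map_append, List.map_map, List.length_cons,
        List.append_assoc]
      congr 2
      · omega
      · congr 2
        split_ifs <;> simp
      · congr 2
        split_ifs <;> simp

/-- As v is not its own neighbour, the first vertex of a fresh pair is never seen in the list that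
creates the pair, so a fresh pair is no hit there. -/
theorem fresh_eq (s : ℕ → Bool) (v : V) (nb : List V) (hv : v ∉ nb) (t : ℕ) (f : V → Bool)
    (hf : ∀ i (h : i < nb.length), f nb[i] = s (t + i)) :
    (fresh s v nb t).map Entry.clear = (nb.filter f).map (Entry.new v · 0) ∧
      ∀ e ∈ fresh s v nb t, e.fst = v ∧ e.snd ∈ nb ∧ e.hit = false ∧ e.cnt = 0 := by
  induction nb generalizing t with
  | nil => simp [fresh]
  | cons w nb ih =>
    simp only [List.mem_cons, not_or] at hv
    obtain ⟨ih1, ih2⟩ := ih hv.2 (t + 1) fun i h => by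
      have := hf (i + 1) (by simpa using h)
      simp only [List.getElem_cons_succ] at this
      rw [this]; congr 1; omega
    have h0 : f w = s t := hf 0 (Nat.succ_pos _)
    constructor
    · rw [fresh, List.map_append, ih1, List.filter_cons, h0, Entry.foldl_touch]
      by_cases hs : s t <;> simp [hs, Entry.clear, Entry.new]
    · intro e he
      rw [fresh, List.mem_append] at he
      rcases he with he | he
      · by_cases hs : s t
        · simp only [hs, if_true, List.mem_singleton] at he
          subst he
          rw [Entry.foldl_touch]
          simp [Entry.new, Entry.hit, hv.2]
        · simp [hs] at he
      · obtain ⟨h1, h2, h3⟩ := ih2 e he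
        exact ⟨h1, by simp [h2], h3⟩

end

end TriangleStream


namespace TriangleStream

/-! ### The items of the triangle process -/

section Semantics

variable {V : Type} [DecidableEq V]

/-- The entries of `P` after `x`. -/
def after (P : List V) (x : V) : List V := P.drop (P.idxOf x + 1)

theorem after_of_notMem {P : List V} {x : V} (h : x ∉ P) : after P x = [] := by
  rw [after, List.idxOf_of_notMem h]
  simp

theorem after_concat {P : List V} {v : V} (hv : v ∉ P) (x : V) :
    after (P ++ [v]) x = if x ∈ P then after P x ++ [v] else [] := by
  split_ifs with h
  · rw [after, List.idxOf_append_of_mem h, List.drop_append_of_le_length]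
    · rfl
    · exact List.idxOf_lt_length_of_mem h
  · by_cases hx : x = v
    · subst hx
      simp [after, List.idxOf_append_of_notMem hv]
    · exact after_of_notMem (by simp [h, hx])

theorem mem_of_mem_after {P : List V} {x y : V} (h : y ∈ after P x) : y ∈ P :=
  List.mem_of_mem_drop h

theorem left_mem_of_mem_after {P : List V} {x y : V} (h : y ∈ after P x) : x ∈ P := by
  by_contra hx
  simp [after_of_notMem hx] at h

variable (nb : V → List V) (f₁ f₂ : V → V → Bool) (Q K : ℕ)

/-- The common neighbours of `x` and `y` that come after `y` in `P`. -/
def apexes (P : List V) (x y : V) : List V :=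
  (after P y).filter fun z => decide (x ∈ nb z) && decide (y ∈ nb z)

theorem apexes_concat {P : List V} {v : V} (hv : v ∉ P) (x y : V) :
    apexes nb (P ++ [v]) x y = if y ∈ P then apexes nb P x y ++
      (if x ∈ nb v ∧ y ∈ nb v then [v] else []) else [] := by
  rw [apexes, after_concat hv]
  split_ifs with h h' <;> simp_all [apexes, List.filter_append]

/-- The number of common neighbours `z` of `x` and `y` whose pair `(x, z)` is in the first
sample. -/
def witnesses (x y : V) : ℕ :=
  if x ∈ nb y then ((nb x).filter (f₁ x)).countP fun z => decide (z ∈ nb y) else 0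

/-- The value that the counter of `(x, w)` has in the second sample. -/
def pairCount (P : List V) (x w : V) : ℕ :=
  if w ∈ after P x ∧ witnesses nb f₁ x w < K then 1 + (apexes nb P x w).length else 0

/-- The common neighbours that are counted for the light pair `(x, w)`. -/
def kept (P : List V) (x w : V) : List V :=
  if w ∈ after P x ∧ witnesses nb f₁ x w < K then (apexes nb P x w).take (2 * K * Q) else []

/-- What the `j`-th item of the heavy pair `(x, y)` has become. -/
def watched (P : List V) (x y : V) (j : ℕ) : Item V :=
  match (apexes nb P x y)[j]? with
  | some z => Item.tri x y z
  | none => Item.watch (Entry.new x y (j - (apexes nb P x y).length))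

theorem pairCount_concat {P : List V} {v : V} (hv : v ∉ P) (hvv : v ∉ nb v) {x : V} (hx : x ∈ P)
    (w : V) :
    pairCount nb f₁ K (P ++ [v]) x w =
      if w = v then (if witnesses nb f₁ x w < K then 1 else pairCount nb f₁ K P x w)
      else if (x ∈ nb v ∧ w ∈ nb v) ∧ 0 < pairCount nb f₁ K P x w
        then pairCount nb f₁ K P x w + 1 else pairCount nb f₁ K P x w := by
  have hmem : w ∈ after (P ++ [v]) x ↔ w ∈ after P x ∨ w = v := by
    rw [after_concat hv, if_pos hx]; simp
  simp only [pairCount, hmem, apexes_concat nb hv]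
  by_cases hwv : w = v
  · subst hwv
    have : w ∉ after P x := fun h => hv (mem_of_mem_after h)
    simp [hv, this]
  · by_cases hw : w ∈ after P x
    · have hwP := mem_of_mem_after hw
      by_cases hk : witnesses nb f₁ x w < K
      · by_cases hc : x ∈ nb v ∧ w ∈ nb v
        · simp [hwv, hw, hwP, hk, hc, add_assoc]
        · simp [hwv, hw, hwP, hk, hc]
      · simp [hwv, hk]
    · simp [hwv, hw]

/-- Since the counter exceeds the number of apexes by one, being at most 2KQ means that fewer than
2KQ apexes have been kept and the next one still fits. -/
theorem kept_concat {P : List V} {v : V} (hv : v ∉ P) (hvv : v ∉ nb v) {x : V} (hx : x ∈ P)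
    (w : V) :
    kept nb f₁ Q K (P ++ [v]) x w = kept nb f₁ Q K P x w ++
      if (x ∈ nb v ∧ w ∈ nb v) ∧ 1 ≤ pairCount nb f₁ K P x w ∧ pairCount nb f₁ K P x w ≤ 2 * K * Q
        then [v] else [] := by
  have hmem : w ∈ after (P ++ [v]) x ↔ w ∈ after P x ∨ w = v := by
    rw [after_concat hv, if_pos hx]; simp
  simp only [kept, pairCount, hmem, apexes_concat nb hv]
  by_cases hwv : w = v
  · subst hwv
    have : w ∉ after P x := fun h => hv (mem_of_mem_after h)
    simp [hv, this]
  · by_cases hw : w ∈ after P x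
    · have hwP := mem_of_mem_after hw
      by_cases hk : witnesses nb f₁ x w < K
      · by_cases hc : x ∈ nb v ∧ w ∈ nb v
        · by_cases hl : 1 + (apexes nb P x w).length ≤ 2 * K * Q
          · simp only [hw, hwP, hk, hc, hl, true_or, and_self, if_true, Nat.le_add_right]
            rw [List.take_of_length_le (by simp; omega),
              List.take_of_length_le (by omega)]
          · simp only [hw, hwP, hk, hc, hl, true_or, and_self, if_true, and_false,
              if_false, List.append_nil]
            rw [List.take_append_of_le_length (by omega)]
        · simp [hw, hwP, hk, hc]
      · simp [hk]
    · simp [hwv, hw]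

/-- The counter of a waiting item drops by one at each apex, and at 0 the next apex is taken; hence
item j takes apex number j, counted from 0. -/
theorem watched_concat {P : List V} {v : V} (hv : v ∉ P) {x y : V} (hy : y ∈ P) (j : ℕ) :
    ((nb v).foldl Item.touch (watched nb P x y j)).finish v = watched nb (P ++ [v]) x y j := by
  have hA := apexes_concat nb hv x y
  rw [if_pos hy] at hA
  unfold watched
  rw [hA]
  by_cases hj : j < (apexes nb P x y).length
  · rw [List.getElem?_append_left hj, List.getElem?_eq_getElem hj]
    simp [Item.foldl_touch_tri, Item.finish]
  · push Not at hj
    rw [List.getElem?_eq_none hj, List.getElem?_append_right hj]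
    simp only [Item.foldl_touch_watch, Entry.foldl_touch, Item.finish, Entry.hit, Entry.new,
      Bool.false_or, Bool.and_eq_true, decide_eq_true_eq, Entry.clear]
    by_cases hc : x ∈ nb v ∧ y ∈ nb v
    · by_cases h0 : j = (apexes nb P x y).length
      · subst h0; simp [hc]
      · have h1 : j - (apexes nb P x y).length ≠ 0 := by omega
        have h2 : 1 ≤ j - (apexes nb P x y).length := by omega
        simp only [hc, and_self, if_true, h1, if_false, List.getElem?_singleton]
        simp [Nat.sub_sub]
    · simp [hc]

/-- The first (second) sample after the vertices in `P`. -/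
def sample (f : V → V → Bool) (c : V → V → ℕ) (P : List V) : List (Entry V) :=
  P.flatMap fun u => ((nb u).filter (f u)).map fun w => Entry.new u w (c u w)

theorem hits_append (l l' : List (Entry V)) (x : V) : hits (l ++ l') x = hits l x + hits l' x :=
  List.countP_append

/-- A sampled token (x, z) is tested against the list of every later vertex v, wherever z stands in
the order. So witnesses run over all common neighbours of x and v, not only over apexes. -/
theorem hits_sample {P : List V} (hP : P.Nodup) (v x : V) :
    hits ((sample nb f₁ (fun _ _ => 0) P).map ((nb v).foldl Entry.touch)) x
      = if x ∈ P then witnesses nb f₁ x v else 0 := by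
  induction P with
  | nil => simp [sample, hits]
  | cons u P ih =>
    rw [List.nodup_cons] at hP
    have h1 : hits ((((nb u).filter (f₁ u)).map fun w => Entry.new u w 0).map
        ((nb v).foldl Entry.touch)) x = if x = u then witnesses nb f₁ x v else 0 := by
      rw [hits, List.map_map, List.countP_map]
      by_cases hx : x = u
      · subst hx
        rw [witnesses, if_pos rfl]
        by_cases hxv : x ∈ nb v
        · rw [if_pos hxv]
          congr 1
          funext w
          simp [Entry.foldl_touch, Entry.new, Entry.hit, hxv]
        · rw [if_neg hxv, List.countP_eq_zero]
          intro w _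
          simp [Entry.foldl_touch, Entry.new, Entry.hit, hxv]
      · rw [if_neg hx, List.countP_eq_zero]
        intro w _
        simp [Entry.foldl_touch, Entry.new, Ne.symm hx]
    rw [sample, List.flatMap_cons, List.map_append, hits_append, h1]
    change _ + hits ((sample nb f₁ (fun _ _ => 0) P).map _) x = _
    rw [ih hP.2]
    by_cases hx : x = u
    · subst hx; simp [hP.1]
    · simp [hx]

end Semantics

end TriangleStream


namespace TriangleStream

/-! ### The state after a prefix of the vertex order -/

section Semantics

variable {n : ℕ} (nb : Fin n → List (Fin n)) (f₁ f₂ : Fin n → Fin n → Bool) (Q K : ℕ)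

/-- The part of the stream that belongs to the vertices in `P`. -/
def vertexStream (P : List (Fin n)) : List (Fin n × Fin n) :=
  P.flatMap fun v => (nb v).map (Prod.mk v)

/-- The sum of `F` over the items that the heavy pairs starting in `x` have become. -/
def heavySum (P : List (Fin n)) (F : Item (Fin n) → ℕ) (x : Fin n) : ℕ :=
  ((after P x).map fun y => if K ≤ witnesses nb f₁ x y then
    ((List.range (2 * witnesses nb f₁ x y * Q)).map fun j => F (watched nb P x y j)).sum else 0).sum

/-- The sum of `F` over the items produced by light pairs starting in `x`. -/
def lightSum (P : List (Fin n)) (F : Item (Fin n) → ℕ) (x : Fin n) : ℕ :=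
  (((nb x).filter (f₂ x)).map fun w =>
    Q * ((kept nb f₁ Q K P x w).map fun z => F (Item.tri x w z)).sum).sum

variable {nb f₁ f₂ Q K}

theorem heavySum_concat {P : List (Fin n)} {v : Fin n} (hv : v ∉ P)
    (F : Item (Fin n) → ℕ) (x : Fin n) :
    heavySum nb f₁ Q K (P ++ [v]) F x =
      heavySum nb f₁ Q K P (fun i => F ((((nb v).foldl Item.touch) i).finish v)) x +
      if x ∈ P then (if K ≤ witnesses nb f₁ x v then
        ((List.range (2 * witnesses nb f₁ x v * Q)).map fun j =>
          F (Item.watch (Entry.new x v j))).sum else 0) else 0 := by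
  rw [heavySum, after_concat hv]
  by_cases hx : x ∈ P
  · rw [if_pos hx, if_pos hx, List.map_append, List.sum_append, heavySum]
    congr 1
    · congr 1
      refine List.map_congr_left fun y hy => ?_
      simp only [watched_concat nb hv (mem_of_mem_after hy)]
    · simp [watched, apexes_concat nb hv, hv]
  · simp [hx, heavySum, after_of_notMem hx]

theorem sum_map_heavyItems (l : List (Entry (Fin n))) (v x : Fin n) (F : Item (Fin n) → ℕ) :
    ((Core.heavyItems Q K l v x).map F).sum = if K ≤ hits l x then
      ((List.range (2 * hits l x * Q)).map fun j => F (Item.watch (Entry.new x v j))).sum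
      else 0 := by
  rw [Core.heavyItems]
  split_ifs
  · rw [List.map_map]; rfl
  · rfl

theorem sum_map_lightItems (v : Fin n) (e : Entry (Fin n)) (F : Item (Fin n) → ℕ) :
    ((Core.lightItems Q K v e).map F).sum = if e.hit ∧ 1 ≤ e.cnt ∧ e.cnt ≤ 2 * K * Q then
      Q * F (Item.tri e.fst e.snd v) else 0 := by
  rw [Core.lightItems]
  split_ifs
  · simp
  · rfl

theorem sum_map_flatMap {α β : Type} (l : List α) (g : α → List β) (F : β → ℕ) :
    ((l.flatMap g).map F).sum = (l.map fun a => ((g a).map F).sum).sum := by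
  induction l with
  | nil => rfl
  | cons a l ih => simp [ih]

/-- Induction on the vertices, for the state with its last list closed. The items are described up
to order by the sums of an arbitrary `F`; in the step the induction hypothesis is applied to `F`
composed with the evolution of an item during the new list. -/
theorem full_vertexStream {s₁ s₂ : ℕ → Bool} (hK : 1 ≤ K) (hvv : ∀ v, v ∉ nb v)
    {P : List (Fin n)} (hP : P.Nodup) (hne : ∀ v ∈ P, nb v ≠ [])
    (hf₁ : ∀ P' v, P' ++ [v] <+: P → ∀ i (h : i < (nb v).length),
      f₁ v (nb v)[i] = s₁ ((vertexStream nb P').length + i))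
    (hf₂ : ∀ P' v, P' ++ [v] <+: P → ∀ i (h : i < (nb v).length),
      f₂ v (nb v)[i] = s₂ ((vertexStream nb P').length + i))
    {q : Core (Fin n) × List (Item (Fin n))}
    (hq : q = (triangleProcess n Q K s₁ s₂).full (vertexStream nb P)) :
    (∀ v ∉ P, q.1.cur ≠ some v) ∧
    q.1.finish K = ⟨none, (vertexStream nb P).length, sample nb f₁ (fun _ _ => 0) P,
      sample nb f₂ (pairCount nb f₁ K P) P⟩ ∧
    ∀ F, ((finishAll Q K q).2.map F).sum
      = ∑ x, heavySum nb f₁ Q K P F x + (P.map (lightSum nb f₁ f₂ Q K P F)).sum := by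
  induction P using List.reverseRecOn generalizing q with
  | nil =>
    subst hq
    refine ⟨fun v _ => by simp [vertexStream, ItemProcess.full, triangleProcess], rfl, fun F => ?_⟩
    simp [vertexStream, ItemProcess.full, triangleProcess, finishAll, Core.batch, heavySum, after]
  | append_singleton P v ih =>
    have hv : v ∉ P := by
      rw [List.nodup_append] at hP
      exact fun h => hP.2.2 v h v (by simp) rfl
    obtain ⟨ih1, ih2, ih3⟩ := ih (hP.of_append_left) (fun u hu => hne u (by simp [hu]))
      (fun P' u h => hf₁ P' u (h.trans (List.prefix_append _ _)))
      (fun P' u h => hf₂ P' u (h.trans (List.prefix_append _ _))) rfl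
    generalize hq₀ : (triangleProcess n Q K s₁ s₂).full (vertexStream nb P) = q₀ at ih1 ih2 ih3
    have hnv : nb v ≠ [] := hne v (by simp)
    have hstream : vertexStream nb (P ++ [v]) = vertexStream nb P ++ (nb v).map (Prod.mk v) := by
      simp [vertexStream]
    have hq' : q = ((nb v).map (Prod.mk v)).foldl (readAll s₁ s₂) (finishAll Q K q₀) := by
      rw [hq, hstream, ← foldl_fullStep_of_cur_ne (ih1 v hv) hnv, ← hq₀]
      simp [ItemProcess.full]
    rw [foldl_readAll v _ hnv] at hq'
    have hfst : (finishAll Q K q₀).1 = q₀.1.finish K := rfl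
    rw [hfst, ih2] at hq'
    simp only at hq'
    obtain ⟨fr1, fr1'⟩ := fresh_eq s₁ v (nb v) (hvv v) (vertexStream nb P).length (f₁ v)
      (hf₁ P v (List.prefix_refl _))
    obtain ⟨fr2, fr2'⟩ := fresh_eq s₂ v (nb v) (hvv v) (vertexStream nb P).length (f₂ v)
      (hf₂ P v (List.prefix_refl _))
    generalize fresh s₁ v (nb v) (vertexStream nb P).length = F₁ at hq' fr1 fr1'
    generalize fresh s₂ v (nb v) (vertexStream nb P).length = F₂ at hq' fr2 fr2'
    set S₁ := (sample nb f₁ (fun _ _ => 0) P).map ((nb v).foldl Entry.touch) ++ F₁ with hS₁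
    have hhits : ∀ x, hits S₁ x = if x ∈ P then witnesses nb f₁ x v else 0 := by
      intro x
      rw [hS₁, hits_append, hits_sample nb f₁ hP.of_append_left]
      have : hits F₁ x = 0 := by
        rw [hits, List.countP_eq_zero]
        intro e he
        simp [(fr1' e he).2.2.1]
      rw [this, add_zero]
    have hsample : ∀ f c, sample nb f c (P ++ [v]) = sample nb f c P
        ++ ((nb v).filter (f v)).map fun w => Entry.new v w (c v w) := by
      intro f c; simp [sample]
    refine ⟨?_, ?_, ?_⟩
    · intro u hu
      rw [hq']
      simp only [ne_eq, Option.some.injEq]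
      rintro rfl
      simp at hu
    · rw [hq']
      simp only [Core.finish, hstream, List.length_append, List.length_map]
      congr 1
      · rw [hS₁, List.map_append, fr1, hsample]
        congr 1
        rw [sample, List.map_flatMap, List.map_flatMap]
        refine List.flatMap_congr fun u _ => ?_
        rw [List.map_map, List.map_map]
        refine List.map_congr_left fun w _ => ?_
        simp [Entry.foldl_touch, Entry.clear, Entry.new]
      · rw [List.map_append, hsample]
        congr 1
        · rw [sample, sample, List.map_flatMap, List.map_flatMap]
          refine List.flatMap_congr fun u hu => ?_
          rw [List.map_map, List.map_map]
          refine List.map_congr_left fun w _ => ?_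
          rw [pairCount_concat nb f₁ K hv (hvv v) hu w]
          by_cases hwv : w = v <;>
            simp [Entry.foldl_touch, advance, Entry.new, Entry.hit, hhits, hu, hwv]
        · have : F₂.map (advance K S₁ v) = F₂.map Entry.clear := by
            refine List.map_congr_left fun e he => ?_
            obtain ⟨h1, h2, h3, h4⟩ := fr2' e he
            have : e.snd ≠ v := by rintro h; rw [h] at h2; exact hvv v h2
            simp [advance, Entry.clear, this, h3]
          rw [this, fr2]
          refine List.map_congr_left fun w _ => ?_
          simp [pairCount, after_concat hv, hv]
    · intro F
      have hL : (finishAll Q K q).2 = (finishAll Q K q₀).2.map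
          (fun i => (((nb v).foldl Item.touch) i).finish v) ++
          ((List.finRange n).flatMap (Core.heavyItems Q K S₁ v) ++
          ((sample nb f₂ (pairCount nb f₁ K P) P).map ((nb v).foldl Entry.touch) ++ F₂).flatMap
            (Core.lightItems Q K v)) := by
        rw [hq']
        simp only [finishAll, Core.batch, List.map_map]
        rfl
      rw [hL, List.map_append, List.sum_append, List.map_map, Function.comp_def, ih3,
        List.map_append, List.sum_append, sum_map_flatMap, List.flatMap_append, List.map_append,
        List.sum_append]
      have hF₂ : F₂.flatMap (Core.lightItems Q K v) = [] := by
        rw [List.flatMap_eq_nil_iff]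
        intro e he
        simp [Core.lightItems, (fr2' e he).2.2.1]
      rw [hF₂, List.map_nil, List.sum_nil, add_zero]
      have hheavy : ((List.finRange n).map fun x => ((Core.heavyItems Q K S₁ v x).map F).sum).sum
          = ∑ x, if x ∈ P then (if K ≤ witnesses nb f₁ x v then
            ((List.range (2 * witnesses nb f₁ x v * Q)).map fun j =>
              F (Item.watch (Entry.new x v j))).sum else 0) else 0 := by
        rw [← Fin.sum_univ_def]
        refine Finset.sum_congr rfl fun x _ => ?_
        rw [sum_map_heavyItems, hhits]
        by_cases hx : x ∈ P
        · simp [hx]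
        · simp only [hx, if_false]
          -- Here `1 ≤ K` is essential: a pair without witnesses must not count as heavy.
          rw [if_neg (by omega)]
      have hlight : ((((sample nb f₂ (pairCount nb f₁ K P) P).map
            ((nb v).foldl Entry.touch)).flatMap (Core.lightItems Q K v)).map F).sum
          = (P.map fun x => (((nb x).filter (f₂ x)).map fun w =>
              if (x ∈ nb v ∧ w ∈ nb v) ∧ 1 ≤ pairCount nb f₁ K P x w
                ∧ pairCount nb f₁ K P x w ≤ 2 * K * Q then Q * F (Item.tri x w v)
              else 0).sum).sum := by
        rw [sum_map_flatMap, List.map_map, sample]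
        rw [← Function.comp_def, sum_map_flatMap]
        congr 1
        refine List.map_congr_left fun x _ => ?_
        rw [List.map_map]
        congr 1
        refine List.map_congr_left fun w _ => ?_
        simp only [Function.comp_apply, sum_map_lightItems, Entry.foldl_touch, Entry.new, Entry.hit,
          Bool.false_or, Bool.and_eq_true, decide_eq_true_eq]
      rw [hheavy, hlight]
      -- Nothing follows v yet, so no pair starting in v has apexes.
      have hlast : lightSum nb f₁ f₂ Q K (P ++ [v]) F v = 0 := by
        simp [lightSum, kept, after_concat hv, hv]
      have hlights : ∀ x ∈ P, lightSum nb f₁ f₂ Q K (P ++ [v]) F x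
          = lightSum nb f₁ f₂ Q K P (fun i => F ((((nb v).foldl Item.touch) i).finish v)) x +
            (((nb x).filter (f₂ x)).map fun w =>
              if (x ∈ nb v ∧ w ∈ nb v) ∧ 1 ≤ pairCount nb f₁ K P x w
                ∧ pairCount nb f₁ K P x w ≤ 2 * K * Q then Q * F (Item.tri x w v)
              else 0).sum := by
        intro x hx
        rw [lightSum, lightSum, ← List.sum_map_add]
        congr 1
        refine List.map_congr_left fun w _ => ?_
        rw [kept_concat nb f₁ Q K hv (hvv v) hx, List.map_append, List.sum_append, mul_add]
        congr 1
        · simp [Item.foldl_touch_tri, Item.finish]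
        · split_ifs <;> simp
      rw [List.map_append, List.sum_append, List.map_singleton, List.sum_singleton, hlast,
        add_zero, List.map_congr_left hlights, List.sum_map_add]
      simp_rw [heavySum_concat hv]
      rw [Finset.sum_add_distrib]
      ring

end Semantics

end TriangleStream


namespace TriangleStream

/-! ### The space used by the triangle process -/

section Space

variable {n Q K : ℕ} {s₁ s₂ : ℕ → Bool}

def itemCount {V : Type} : Item V → ℕ
  | Item.watch e => e.cnt
  | Item.tri _ _ _ => 0

/-- Bounds for the sizes of everything in the state of the process after `T` tokens. -/
structure Bounded (Q : ℕ) (s₁ s₂ : ℕ → Bool) (T : ℕ) (q : Core (Fin n) × List (Item (Fin n))) :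
    Prop where
  time : q.1.time = T
  length₁ : q.1.S₁.length = ((Finset.range T).filter fun i => s₁ i).card
  length₂ : q.1.S₂.length = ((Finset.range T).filter fun i => s₂ i).card
  cnt₁ : ∀ e ∈ q.1.S₁, e.cnt ≤ T
  cnt₂ : ∀ e ∈ q.1.S₂, e.cnt ≤ T
  items : q.2.length ≤ 3 * Q * T ^ 2
  itemCount : ∀ i ∈ q.2, itemCount i ≤ 2 * Q * T

theorem card_filter_range_le (s : ℕ → Bool) (T : ℕ) :
    ((Finset.range T).filter fun i => s i).card ≤ T :=
  (Finset.card_filter_le _ _).trans_eq (Finset.card_range T)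

/-- A sampled entry is a hit for its own first vertex only. -/
theorem sum_hits_le (l : List (Entry (Fin n))) :
    ((List.finRange n).map fun x => hits l x).sum ≤ l.length := by
  rw [← Fin.sum_univ_def]
  induction l with
  | nil => simp [hits]
  | cons e l ih =>
    simp only [hits, List.countP_cons, Finset.sum_add_distrib, List.length_cons] at ih ⊢
    refine Nat.add_le_add ih ?_
    calc ∑ x, (if (e.hit && decide (e.fst = x)) = true then 1 else 0)
        ≤ ∑ x, (if e.fst = x then 1 else 0) := by
          refine Finset.sum_le_sum fun x _ => ?_
          by_cases h : e.fst = x <;> simp [h]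
          split_ifs <;> simp
      _ = 1 := by simp

theorem length_batch_le (c : Core (Fin n)) :
    (c.batch Q K).length ≤ 2 * Q * c.S₁.length + Q * c.S₂.length := by
  rw [Core.batch]
  split
  · simp
  · rename_i v _
    rw [List.length_append, List.length_flatMap, List.length_flatMap]
    refine Nat.add_le_add ?_ ?_
    · calc ((List.finRange n).map fun x => (Core.heavyItems Q K c.S₁ v x).length).sum
          ≤ ((List.finRange n).map fun x => 2 * Q * hits c.S₁ x).sum := by
            refine List.sum_le_sum fun x _ => ?_
            rw [Core.heavyItems]
            split_ifs
            · simp only [List.length_map, List.length_range]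
              exact le_of_eq (by ring)
            · simp
        _ = 2 * Q * ((List.finRange n).map fun x => hits c.S₁ x).sum := by
            rw [List.sum_map_mul_left]
        _ ≤ _ := Nat.mul_le_mul_left _ (sum_hits_le _)
    · calc (c.S₂.map fun e => (Core.lightItems Q K v e).length).sum
          ≤ (c.S₂.map fun _ => Q).sum := by
            refine List.sum_le_sum fun e _ => ?_
            rw [Core.lightItems]
            split_ifs <;> simp
        _ = Q * c.S₂.length := by simp [mul_comm]

theorem itemCount_batch_le (c : Core (Fin n)) :
    ∀ i ∈ c.batch Q K, itemCount i ≤ 2 * Q * c.S₁.length := by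
  intro i hi
  rw [Core.batch] at hi
  split at hi
  · simp at hi
  · rename_i v _
    rw [List.mem_append, List.mem_flatMap, List.mem_flatMap] at hi
    rcases hi with ⟨x, _, hi⟩ | ⟨e, _, hi⟩
    · rw [Core.heavyItems] at hi
      split_ifs at hi
      · obtain ⟨j, hj, rfl⟩ := List.mem_map.1 hi
        have h1 : hits c.S₁ x ≤ c.S₁.length := List.countP_le_length
        simp only [itemCount, Entry.new, List.mem_range] at hj ⊢
        nlinarith
      · simp at hi
    · rw [Core.lightItems] at hi
      split_ifs at hi
      · rw [(List.mem_replicate.1 hi).2]; simp [itemCount]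
      · simp at hi

theorem itemCount_touch (i : Item (Fin n)) (w : Fin n) : itemCount (i.touch w) = itemCount i := by
  cases i <;> rfl

theorem itemCount_finishItem_le (c : Core (Fin n)) (i : Item (Fin n)) :
    itemCount (c.finishItem i) ≤ itemCount i := by
  rw [Core.finishItem]
  split
  · exact le_rfl
  · cases i with
    | tri x y z => exact le_rfl
    | watch e =>
      simp only [Item.finish]
      split_ifs <;> simp [itemCount, Entry.new, Entry.clear]

theorem Bounded.readAll {T : ℕ} {q : Core (Fin n) × List (Item (Fin n))}
    (ht : q.1.time = T)
    (h₁ : q.1.S₁.length = ((Finset.range T).filter fun i => s₁ i).card)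
    (h₂ : q.1.S₂.length = ((Finset.range T).filter fun i => s₂ i).card)
    (hc₁ : ∀ e ∈ q.1.S₁, e.cnt ≤ T + 1) (hc₂ : ∀ e ∈ q.1.S₂, e.cnt ≤ T + 1)
    (hl : q.2.length ≤ 3 * Q * (T + 1) ^ 2)
    (hi : ∀ i ∈ q.2, TriangleStream.itemCount i ≤ 2 * Q * (T + 1)) (t : Fin n × Fin n) :
    Bounded Q s₁ s₂ (T + 1) (readAll s₁ s₂ q t) := by
  refine ⟨?_, ?_, ?_, ?_, ?_, ?_, ?_⟩
  · simp [TriangleStream.readAll, Core.read, ht]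
  · rw [Finset.range_add_one, Finset.filter_insert]
    simp only [TriangleStream.readAll, Core.read, ht, List.length_append, List.length_map, h₁]
    split_ifs <;> simp
  · rw [Finset.range_add_one, Finset.filter_insert]
    simp only [TriangleStream.readAll, Core.read, ht, List.length_append, List.length_map, h₂]
    split_ifs <;> simp
  · intro e he
    simp only [TriangleStream.readAll, Core.read, List.mem_append, List.mem_map] at he
    rcases he with ⟨e', he', rfl⟩ | he
    · exact hc₁ e' he'
    · split_ifs at he
      · rw [List.mem_singleton.1 he]; simp [Entry.new]
      · simp at he
  · intro e he
    simp only [TriangleStream.readAll, Core.read, List.mem_append, List.mem_map] at he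
    rcases he with ⟨e', he', rfl⟩ | he
    · exact hc₂ e' he'
    · split_ifs at he
      · rw [List.mem_singleton.1 he]; simp [Entry.new]
      · simp at he
  · simpa [TriangleStream.readAll] using hl
  · intro i hi'
    simp only [TriangleStream.readAll, List.mem_map] at hi'
    obtain ⟨j, hj, rfl⟩ := hi'
    rw [itemCount_touch]
    exact hi j hj

/-- After T tokens a batch adds at most (2Q + Q)T items. Such crude polynomial bounds suffice,
because these numbers enter the space only through their bit lengths. -/
theorem bounded_full (s : List (Fin n × Fin n)) :
    Bounded Q s₁ s₂ s.length ((triangleProcess n Q K s₁ s₂).full s) := by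
  induction s using List.reverseRecOn with
  | nil => constructor <;> simp [ItemProcess.full, triangleProcess]
  | append_singleton s t ih =>
    rw [ItemProcess.full_concat, List.length_append, List.length_singleton]
    generalize (triangleProcess n Q K s₁ s₂).full s = q at ih ⊢
    generalize s.length = T at ih ⊢
    by_cases hcur : q.1.cur = some t.1
    · rw [fullStep_of_cur_eq hcur]
      refine Bounded.readAll ih.time ih.length₁ ih.length₂
        (fun e he => (ih.cnt₁ e he).trans T.le_succ) (fun e he => (ih.cnt₂ e he).trans T.le_succ)
        (ih.items.trans ?_) (fun i hi => (ih.itemCount i hi).trans ?_) t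
      · gcongr; omega
      · gcongr; omega
    · rw [fullStep_of_cur_ne hcur]
      have l₁ := card_filter_range_le s₁ T
      have l₂ := card_filter_range_le s₂ T
      rw [← ih.length₁] at l₁
      rw [← ih.length₂] at l₂
      refine Bounded.readAll ?_ ?_ ?_ ?_ ?_ ?_ ?_ t
      · simp only [finishAll, Core.finish]; split <;> exact ih.time
      · rw [← ih.length₁]; simp only [finishAll, Core.finish]; split <;> simp
      · rw [← ih.length₂]; simp only [finishAll, Core.finish]; split <;> simp
      · intro e he
        simp only [finishAll, Core.finish] at he
        split at he
        · exact (ih.cnt₁ e he).trans T.le_succ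
        · obtain ⟨e', he', rfl⟩ := List.mem_map.1 he
          exact (ih.cnt₁ e' he').trans T.le_succ
      · intro e he
        simp only [finishAll, Core.finish] at he
        split at he
        · exact (ih.cnt₂ e he).trans T.le_succ
        · obtain ⟨e', he', rfl⟩ := List.mem_map.1 he
          have := ih.cnt₂ e' he'
          simp only [advance, Entry.new]
          split_ifs <;> omega
      · simp only [finishAll, List.length_append, List.length_map]
        have h1 := length_batch_le (Q := Q) (K := K) q.1
        have h2 := ih.items
        have h3 : 2 * Q * q.1.S₁.length ≤ 2 * Q * T := Nat.mul_le_mul_left _ l₁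
        have h4 : Q * q.1.S₂.length ≤ Q * T := Nat.mul_le_mul_left _ l₂
        have h5 : 3 * Q * (T + 1) ^ 2 = 3 * Q * T ^ 2 + 2 * (2 * Q * T) + 2 * (Q * T) + 3 * Q := by
          ring
        omega
      · intro i hi
        simp only [finishAll, List.mem_append, List.mem_map] at hi
        rcases hi with ⟨j, hj, rfl⟩ | hi
        · refine (itemCount_finishItem_le _ _).trans ((ih.itemCount j hj).trans ?_)
          gcongr; omega
        · refine (itemCount_batch_le _ i hi).trans ?_
          gcongr; omega

/-! ### Bit lengths of the codes of states -/

def entryCode (n : ℕ) : PrefixCode (Entry (Fin n)) :=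
  ((PrefixCode.fin n).prod ((PrefixCode.fin n).prod
    (PrefixCode.bool.prod (PrefixCode.bool.prod PrefixCode.nat)))).comap
    (fun e => (e.fst, e.snd, e.seenFst, e.seenSnd, e.cnt)) fun a b h => by
      cases a; cases b; simp_all

def itemCode (n : ℕ) : PrefixCode (Item (Fin n)) :=
  (PrefixCode.bool.prod (entryCode n)).comap
    (fun i => match i with
      | Item.watch e => (true, e)
      -- The third vertex is stored in the counter field.
      | Item.tri x y z => (false, Entry.new x y z)) fun a b h => by
      cases a <;> cases b <;> simp_all [Entry.new, Fin.val_inj]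

def coreCode (n : ℕ) : PrefixCode (Core (Fin n)) :=
  ((PrefixCode.fin n).option.prod (PrefixCode.nat.prod
    ((entryCode n).list.prod (entryCode n).list))).comap
    (fun c => (c.cur, c.time, c.S₁, c.S₂)) fun a b h => by
      cases a; cases b; simp_all

def seedCode (Q l : ℕ) [NeZero Q] : PrefixCode (Seed Q l) :=
  (PrefixCode.nat.prod PrefixCode.nat.list).comap
    (fun σ => (σ.1.val, List.ofFn fun i => (σ.2 i).val)) fun a b h => by
      simp only [Prod.mk.injEq, List.ofFn_inj] at h
      exact Prod.ext (ZMod.val_injective Q h.1)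
        (funext fun i => ZMod.val_injective Q (congrFun h.2 i))

def stateCode (n Q l : ℕ) [NeZero Q] :
    PrefixCode ((Seed Q l × Seed Q l) × Core (Fin n) × ℕ × Option (Item (Fin n))) :=
  ((seedCode Q l).prod (seedCode Q l)).prod
    ((coreCode n).prod (PrefixCode.nat.prod (itemCode n).option))

theorem length_entryCode_le {b : ℕ} (hn : n ≤ 2 ^ b) (e : Entry (Fin n)) (he : e.cnt < 2 ^ b) :
    ((entryCode n).enc e).length ≤ 6 * b + 5 := by
  change (PrefixCode.enc (PrefixCode.prod _ _) (_, _)).length ≤ _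
  simp only [PrefixCode.length_prod]
  have h1 := PrefixCode.length_fin_le e.fst hn
  have h2 := PrefixCode.length_fin_le e.snd hn
  have h3 := PrefixCode.length_nat_le he
  have h4 : ∀ c, (PrefixCode.bool.enc c).length = 1 := fun c => rfl
  rw [h4, h4]
  omega

theorem length_itemCode_le {b : ℕ} (hn : n ≤ 2 ^ b) (i : Item (Fin n)) (hi : itemCount i < 2 ^ b) :
    ((itemCode n).enc i).length ≤ 6 * b + 6 := by
  have h4 : ∀ c, (PrefixCode.bool.enc c).length = 1 := fun c => rfl
  cases i with
  | watch e =>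
    change (PrefixCode.enc (PrefixCode.prod _ _) (_, e)).length ≤ _
    rw [PrefixCode.length_prod, h4]
    have := length_entryCode_le hn e hi
    dsimp only
    omega
  | tri x y z =>
    change (PrefixCode.enc (PrefixCode.prod _ _) (_, Entry.new x y z)).length ≤ _
    rw [PrefixCode.length_prod, h4]
    have := length_entryCode_le hn (Entry.new x y (z : ℕ)) (z.2.trans_le hn)
    dsimp only
    omega

theorem length_coreCode_le {b N : ℕ} (hn : n ≤ 2 ^ b) (c : Core (Fin n)) (ht : c.time < 2 ^ b)
    (h₁ : c.S₁.length ≤ N) (h₂ : c.S₂.length ≤ N) (hc₁ : ∀ e ∈ c.S₁, e.cnt < 2 ^ b)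
    (hc₂ : ∀ e ∈ c.S₂, e.cnt < 2 ^ b) :
    ((coreCode n).enc c).length ≤ 4 * b + 6 + 2 * (N * (6 * b + 6)) := by
  change (PrefixCode.enc (PrefixCode.prod _ _) (_, _)).length ≤ _
  simp only [PrefixCode.length_prod]
  have h1 := PrefixCode.length_option_le (PrefixCode.fin n) c.cur (2 * b + 1)
    fun a _ => PrefixCode.length_fin_le a hn
  have h2 := PrefixCode.length_nat_le ht
  have h3 := PrefixCode.length_list_le (entryCode n) c.S₁ (6 * b + 5)
    fun e he => length_entryCode_le hn e (hc₁ e he)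
  have h4 := PrefixCode.length_list_le (entryCode n) c.S₂ (6 * b + 5)
    fun e he => length_entryCode_le hn e (hc₂ e he)
  have h5 : c.S₁.length * (6 * b + 5 + 1) ≤ N * (6 * b + 6) := Nat.mul_le_mul_right _ h₁
  have h6 : c.S₂.length * (6 * b + 5 + 1) ≤ N * (6 * b + 6) := Nat.mul_le_mul_right _ h₂
  omega

theorem length_seedCode_le {Q l b : ℕ} [NeZero Q] (hQ : Q ≤ 2 ^ b) (σ : Seed Q l) :
    ((seedCode Q l).enc σ).length ≤ 2 * b + 2 + l * (2 * b + 2) := by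
  change (PrefixCode.enc (PrefixCode.prod _ _) (_, _)).length ≤ _
  simp only [PrefixCode.length_prod]
  have h1 := PrefixCode.length_nat_le ((ZMod.val_lt σ.1).trans_le hQ)
  have h2 := PrefixCode.length_list_le PrefixCode.nat (List.ofFn fun i => (σ.2 i).val) (2 * b + 1)
    fun x hx => by
      obtain ⟨i, rfl⟩ := (List.mem_ofFn' _ _).1 hx
      exact PrefixCode.length_nat_le ((ZMod.val_lt (σ.2 i)).trans_le hQ)
  rw [List.length_ofFn, show 2 * b + 1 + 1 = 2 * b + 2 from rfl] at h2
  omega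

end Space

/-- The triangle sampler with a single copy of the process. -/
noncomputable def triangleSampler (n Q K l : ℕ) [NeZero Q] :
    Algorithm (Fin n × Fin n) (Option (Finset (Fin n))) :=
  ItemProcess.sampler
    (fun σ : Seed Q l × Seed Q l => triangleProcess n Q K σ.1.sampled σ.2.sampled)
    (stateCode n Q l)

/-- Every number in the state is below 2^b and costs O(b) bits. Each of the two seeds consists of l
+ 1 residues, and each sample has at most one entry more than the number of full blocks. -/
theorem triangleSampler_usesSpace {n Q K l b : ℕ} [NeZero Q] (s : List (Fin n × Fin n))
    (hn : n ≤ 2 ^ b) (hb : 3 * Q * (s.length + 1) ^ 2 < 2 ^ b) :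
    (triangleSampler n Q K l).UsesSpace s
      (((b + 1) * (31 + 4 * l + 12 * (s.length / Q)) : ℕ) : ℝ) := by
  refine ItemProcess.sampler_usesSpace _ _ _ _ fun r hr σ o ho => ?_
  have hrs := hr.length_le
  have hB := bounded_full (Q := Q) (K := K) (s₁ := σ.1.sampled) (s₂ := σ.2.sampled) r
  generalize (triangleProcess n Q K σ.1.sampled σ.2.sampled).full r = q at hB ho ⊢
  have hQ := NeZero.pos Q
  have hmono : 3 * Q * (r.length + 1) ^ 2 < 2 ^ b := lt_of_le_of_lt (by gcongr) hb
  have hQb : Q ≤ 2 ^ b := by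
    have := Nat.mul_le_mul_left Q (Nat.one_le_pow 2 (r.length + 1) (by omega))
    nlinarith
  have hrb : r.length < 2 ^ b := by nlinarith [Nat.zero_le r.length]
  have hT := hB.time
  have N₁ := (hB.length₁.trans_le (Seed.card_sampled_le σ.1 r.length)).trans
    (Nat.add_le_add_right (Nat.div_le_div_right (c := Q) hrs) 1)
  have N₂ := (hB.length₂.trans_le (Seed.card_sampled_le σ.2 r.length)).trans
    (Nat.add_le_add_right (Nat.div_le_div_right (c := Q) hrs) 1)
  have h1 := length_seedCode_le hQb σ.1
  have h2 := length_seedCode_le hQb σ.2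
  have h3 := length_coreCode_le hn q.1 (hT.trans_lt hrb) N₁ N₂
    (fun e he => (hB.cnt₁ e he).trans_lt hrb) (fun e he => (hB.cnt₂ e he).trans_lt hrb)
  have h4 : (PrefixCode.nat.enc q.2.length).length ≤ 2 * b + 1 :=
    PrefixCode.length_nat_le (lt_of_le_of_lt (hB.items.trans (by gcongr; omega)) hmono)
  have h5 := PrefixCode.length_option_le (itemCode n) o (6 * b + 6) fun i hi => by
    rcases ho with rfl | ⟨j, hj, rfl⟩
    · simp at hi
    · obtain rfl := Option.some.inj hi
      refine length_itemCode_le hn _ (lt_of_le_of_lt (hB.itemCount _ hj) ?_)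
      nlinarith [Nat.zero_le r.length]
  have hlen : ((stateCode n Q l).enc (σ, q.1, q.2.length, o)).length
      = ((seedCode Q l).enc σ.1).length + ((seedCode Q l).enc σ.2).length +
        (((coreCode n).enc q.1).length + ((PrefixCode.nat.enc q.2.length).length
          + ((itemCode n).option.enc o).length)) := by
    rw [stateCode, PrefixCode.length_prod, PrefixCode.length_prod, PrefixCode.length_prod,
      PrefixCode.length_prod]
  rw [hlen]
  norm_cast
  generalize s.length / Q = N at *
  nlinarith

end TriangleStream


namespace TriangleStream

open BigOperators Finset

/-! ### Analysis of the sampling scheme -/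

section Moments

variable {Ω ι : Type*} [Fintype Ω] [Nonempty Ω]

/-- Second moment of a nonnegative combination of centred pairwise independent indicators. -/
theorem expect_sq_sum_le (E : Finset ι) (c : ι → ℝ) (hc : ∀ e ∈ E, 0 ≤ c e) (s : Ω → ι → ℝ)
    (Q : ℝ) (hQ : 1 ≤ Q) (h01 : ∀ ω, ∀ e ∈ E, s ω e * s ω e = s ω e)
    (h1 : ∀ e ∈ E, 𝔼 ω, s ω e = 1 / Q)
    (h2 : ∀ e ∈ E, ∀ e' ∈ E, e ≠ e' → 𝔼 ω, s ω e * s ω e' ≤ 1 / Q ^ 2) :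
    𝔼 ω, (∑ e ∈ E, c e * (Q * s ω e - 1)) ^ 2 ≤ (Q - 1) * ∑ e ∈ E, c e ^ 2 := by
  classical
  have hQ0 : Q ≠ 0 := by positivity
  -- The variable `Q * s ω e - 1` is centred with variance Q - 1, and covariances are at most 0,
  -- which the nonnegative coefficients preserve. Keeping Q - 1 instead of Q matters later: it
  -- vanishes for Q = 1.
  have key : ∀ e ∈ E, ∀ e' ∈ E, 𝔼 ω, (Q * s ω e - 1) * (Q * s ω e' - 1)
      ≤ if e = e' then Q - 1 else 0 := by
    intro e he e' he'
    have hexp : ∀ ω, (Q * s ω e - 1) * (Q * s ω e' - 1)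
        = Q ^ 2 * (s ω e * s ω e') - Q * s ω e - Q * s ω e' + 1 := fun ω => by ring
    simp_rw [hexp]
    rw [expect_add_distrib, expect_sub_distrib, expect_sub_distrib, ← mul_expect, ← mul_expect,
      ← mul_expect, h1 e he, h1 e' he', Fintype.expect_const]
    split_ifs with h
    · subst h
      have : 𝔼 ω, s ω e * s ω e = 1 / Q := by
        rw [← h1 e he]; exact expect_congr rfl fun ω _ => h01 ω e he
      rw [this]
      apply le_of_eq
      field_simp
      ring
    · have := mul_le_mul_of_nonneg_left (h2 e he e' he' h) (sq_nonneg Q)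
      rw [mul_one_div_cancel (pow_ne_zero 2 hQ0)] at this
      rw [mul_one_div_cancel hQ0]
      linarith
  have hsq : ∀ ω, (∑ e ∈ E, c e * (Q * s ω e - 1)) ^ 2
      = ∑ e ∈ E, ∑ e' ∈ E, (c e * c e') * ((Q * s ω e - 1) * (Q * s ω e' - 1)) := by
    intro ω
    rw [sq, sum_mul_sum]
    exact sum_congr rfl fun e _ => sum_congr rfl fun e' _ => by ring
  simp_rw [hsq, expect_sum_comm, ← mul_expect]
  calc ∑ e ∈ E, ∑ e' ∈ E, c e * c e' * 𝔼 ω, (Q * s ω e - 1) * (Q * s ω e' - 1)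
      ≤ ∑ e ∈ E, ∑ e' ∈ E, c e * c e' * (if e = e' then Q - 1 else 0) :=
        sum_le_sum fun e he => sum_le_sum fun e' he' =>
          mul_le_mul_of_nonneg_left (key e he e' he') (mul_nonneg (hc e he) (hc e' he'))
    _ = (Q - 1) * ∑ e ∈ E, c e ^ 2 := by
        rw [mul_sum]
        refine sum_congr rfl fun e he => ?_
        simp only [mul_ite, mul_zero, sum_ite_eq, he, if_true]
        ring

theorem sq_expect_le (f : Ω → ℝ) : (𝔼 ω, f ω) ^ 2 ≤ 𝔼 ω, f ω ^ 2 := by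
  have := expect_mul_sq_le_sq_mul_sq (univ : Finset Ω) f fun _ => 1
  simpa using this

open Classical in
/-- Chebyshev's inequality for a sum of pairwise independent indicators. -/
theorem expect_sum_lt_half_le (E : Finset ι) (hE : E.Nonempty) (s : Ω → ι → ℝ) (Q : ℝ) (hQ : 1 ≤ Q)
    (h01 : ∀ ω, ∀ e ∈ E, s ω e * s ω e = s ω e)
    (h1 : ∀ e ∈ E, 𝔼 ω, s ω e = 1 / Q)
    (h2 : ∀ e ∈ E, ∀ e' ∈ E, e ≠ e' → 𝔼 ω, s ω e * s ω e' ≤ 1 / Q ^ 2) :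
    𝔼 ω, (if 2 * Q * ∑ e ∈ E, s ω e < (E.card : ℝ) then (1 : ℝ) else 0) ≤ 4 * Q / E.card := by
  have ha : (0 : ℝ) < E.card := by exact_mod_cast hE.card_pos
  have h := expect_sq_sum_le E (fun _ => 1) (fun _ _ => zero_le_one) s Q hQ h01 h1 h2
  calc 𝔼 ω, (if 2 * Q * ∑ e ∈ E, s ω e < (E.card : ℝ) then (1 : ℝ) else 0)
      ≤ 𝔼 ω, 4 / (E.card : ℝ) ^ 2 * (∑ e ∈ E, 1 * (Q * s ω e - 1)) ^ 2 := by
        refine expect_le_expect fun ω _ => ?_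
        split_ifs with hlt
        -- On this event the scaled sum falls short of its mean by more than half of it.
        · have : ∑ e ∈ E, 1 * (Q * s ω e - 1) = Q * ∑ e ∈ E, s ω e - E.card := by
            simp [mul_sum, sum_sub_distrib]
          rw [this, div_mul_eq_mul_div, le_div_iff₀ (by positivity)]
          nlinarith
        · positivity
    _ ≤ 4 / (E.card : ℝ) ^ 2 * ((Q - 1) * E.card) := by
        rw [← mul_expect]
        refine mul_le_mul_of_nonneg_left (h.trans_eq ?_) (by positivity)
        simp
    _ ≤ 4 * Q / E.card := by
        rw [div_mul_eq_mul_div, div_le_div_iff₀ (by positivity) ha]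
        nlinarith [sq_nonneg (E.card : ℝ), mul_pos ha ha, mul_pos (mul_pos ha ha) ha]

end Moments

/-! In the following, `a e` is the number of triangles charged to the pair `e`, `k e` its number of
witnesses, and `s e` tells whether `e` is in the second sample. -/

section Scheme

variable {ι : Type*} (Q K : ℕ) (a k : ι → ℕ)

/-- The number of triangles at `e` that can be reported. -/
def cutoff (e : ι) : ℕ := if K ≤ k e then 2 * k e * Q else 2 * K * Q

def reportable (e : ι) : ℕ := min (a e) (cutoff Q K k e)

/-- The number of items for each reportable triangle at `e`. -/
noncomputable def multiplicity (s : ι → ℝ) (e : ι) : ℝ := if K ≤ k e then 1 else Q * s e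

/-- The number of items at `e`. -/
noncomputable def weight (s : ι → ℝ) (e : ι) : ℝ :=
  if K ≤ k e then 2 * k e * Q else Q * s e * reportable Q K a k e

/-- The expected number of items at `e`. -/
noncomputable def meanWeight (e : ι) : ℝ :=
  if K ≤ k e then 2 * k e * Q else reportable Q K a k e

/-- The probability that the `j`-th triangle at `e` is reported. -/
noncomputable def reportProb (E : Finset ι) (s : ι → ℝ) (e : ι) (j : ℕ) : ℝ :=
  (if j < cutoff Q K k e then multiplicity Q K k s e else 0) / ∑ e ∈ E, weight Q K a k s e

variable {Q K a k} {E : Finset ι}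

theorem multiplicity_nonneg {s : ι → ℝ} {e : ι} (hs : 0 ≤ s e) : 0 ≤ multiplicity Q K k s e := by
  rw [multiplicity]; split_ifs <;> positivity

theorem reportable_mul_multiplicity_le {s : ι → ℝ} {e : ι} :
    reportable Q K a k e * multiplicity Q K k s e ≤ weight Q K a k s e := by
  rw [multiplicity, weight]
  split_ifs with h
  · have : reportable Q K a k e ≤ 2 * k e * Q := by
      rw [reportable, cutoff, if_pos h]; exact min_le_right _ _
    rw [mul_one]; exact_mod_cast this
  · exact le_of_eq (by ring)

theorem weight_nonneg {s : ι → ℝ} {e : ι} (hs : 0 ≤ s e) : 0 ≤ weight Q K a k s e := by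
  rw [weight]; split_ifs <;> positivity

theorem sum_range_ite_lt (a c : ℕ) (x y : ℝ) :
    ∑ j ∈ range a, (if j < c then x else y) = (min a c : ℕ) * x + (a - (min a c : ℕ)) * y := by
  rw [sum_ite, sum_const, sum_const, nsmul_eq_mul, nsmul_eq_mul]
  have h1 : (range a).filter (· < c) = range (min a c) := by
    ext j; simp
  have h2 : ((range a).filter (¬ · < c)).card = a - min a c := by
    have := card_filter_add_card_filter_not (s := range a) (· < c)
    rw [h1, card_range, card_range] at this
    omega
  rw [h1, h2, card_range, Nat.cast_sub (min_le_left _ _)]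

theorem sum_reportProb_le_one {s : ι → ℝ} (hs : ∀ e ∈ E, 0 ≤ s e) :
    ∑ e ∈ E, ∑ j ∈ range (a e), reportProb Q K a k E s e j ≤ 1 := by
  simp only [reportProb]
  simp_rw [← sum_div, sum_range_ite_lt, mul_zero, add_zero]
  refine div_le_one_of_le₀ (sum_le_sum fun e _ => reportable_mul_multiplicity_le)
    (sum_nonneg fun e he => weight_nonneg (hs e he))

theorem reportProb_nonneg {s : ι → ℝ} (hs : ∀ e ∈ E, 0 ≤ s e) {e : ι} (he : e ∈ E) (j : ℕ) :
    0 ≤ reportProb Q K a k E s e j := by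
  rw [reportProb]
  refine div_nonneg ?_ (sum_nonneg fun e he => weight_nonneg (hs e he))
  split_ifs
  · exact multiplicity_nonneg (hs e he)
  · exact le_rfl

variable {Ω : Type*} [Fintype Ω] [Nonempty Ω] {s : Ω → ι → ℝ}

/-- Multiplicities have mean 1, so for a triangle within the cutoff the deviation is the mean of
multiplicity times 1/X - 1/W, with X the number of items. The multiplicities of all these triangles
add up to at most X, and X·|1/X - 1/W| = |W - X|/W. Each triangle beyond the cutoff contributes 1/W.
-/
theorem sum_abs_expect_reportProb_sub_le (hQ : 1 ≤ Q) (hs : ∀ ω, ∀ e ∈ E, 0 ≤ s ω e)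
    (h1 : ∀ e ∈ E, 𝔼 ω, s ω e = 1 / Q) {W : ℝ} (hW : 0 < W) :
    ∑ e ∈ E, ∑ j ∈ range (a e), |𝔼 ω, reportProb Q K a k E (s ω) e j - 1 / W|
      ≤ (∑ e ∈ E, ((a e : ℝ) - reportable Q K a k e)
        + 𝔼 ω, |W - ∑ e ∈ E, weight Q K a k (s ω) e|) / W := by
  have hQ0 : (Q : ℝ) ≠ 0 := by positivity
  set X : Ω → ℝ := fun ω => ∑ e ∈ E, weight Q K a k (s ω) e with hX
  have hX0 : ∀ ω, 0 ≤ X ω := fun ω => sum_nonneg fun e he => weight_nonneg (hs ω e he)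
  have hmean : ∀ e ∈ E, 𝔼 ω, multiplicity Q K k (s ω) e = 1 := by
    intro e he
    simp only [multiplicity]
    split_ifs
    · simp
    · rw [← mul_expect, h1 e he, mul_one_div_cancel hQ0]
  have hterm : ∀ e ∈ E, ∀ j, |𝔼 ω, reportProb Q K a k E (s ω) e j - 1 / W|
      ≤ if j < cutoff Q K k e then 𝔼 ω, multiplicity Q K k (s ω) e * |1 / X ω - 1 / W|
        else 1 / W := by
    intro e he j
    split_ifs with hj
    · have : 𝔼 ω, reportProb Q K a k E (s ω) e j - 1 / W
          = 𝔼 ω, multiplicity Q K k (s ω) e * (1 / X ω - 1 / W) := by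
        simp only [reportProb, hj, if_true, mul_sub, expect_sub_distrib]
        rw [← expect_mul, hmean e he, one_mul]
        congr 1
        exact expect_congr rfl fun ω _ => by rw [mul_one_div]
      rw [this]
      refine (abs_expect_le _ _).trans_eq (expect_congr rfl fun ω _ => ?_)
      rw [abs_mul, abs_of_nonneg (multiplicity_nonneg (hs ω e he))]
    · simp only [reportProb, hj, if_false, zero_div, expect_const_zero, zero_sub, abs_neg]
      rw [abs_of_pos (by positivity)]
  calc ∑ e ∈ E, ∑ j ∈ range (a e), |𝔼 ω, reportProb Q K a k E (s ω) e j - 1 / W|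
      ≤ ∑ e ∈ E, ∑ j ∈ range (a e), (if j < cutoff Q K k e then
          𝔼 ω, multiplicity Q K k (s ω) e * |1 / X ω - 1 / W| else 1 / W) :=
        sum_le_sum fun e he => sum_le_sum fun j _ => hterm e he j
    _ = ∑ e ∈ E, ((a e : ℝ) - reportable Q K a k e) * (1 / W) + 𝔼 ω, (∑ e ∈ E,
          reportable Q K a k e * multiplicity Q K k (s ω) e) * |1 / X ω - 1 / W| := by
        simp_rw [sum_range_ite_lt, sum_mul, expect_sum_comm]
        rw [← sum_add_distrib]
        refine sum_congr rfl fun e _ => ?_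
        simp_rw [mul_assoc]
        rw [← mul_expect, add_comm]
        rfl
    _ ≤ ∑ e ∈ E, ((a e : ℝ) - reportable Q K a k e) * (1 / W) + 𝔼 ω, |W - X ω| / W := by
        refine add_le_add le_rfl (expect_le_expect fun ω _ => ?_)
        refine (mul_le_mul_of_nonneg_right
          (sum_le_sum fun e _ => reportable_mul_multiplicity_le) (abs_nonneg _)).trans ?_
        change X ω * _ ≤ _
        -- Without items `1 / X ω` is 0 by convention, and the factor X removes the term.
        rcases (hX0 ω).eq_or_lt with h0 | h0
        · rw [← h0, zero_mul]; positivity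
        · rw [div_sub_div _ _ h0.ne' hW.ne', abs_div, one_mul, mul_one, abs_of_pos (mul_pos h0 hW)]
          apply le_of_eq
          field_simp
    _ = _ := by
        rw [← sum_mul, ← expect_div, mul_one_div, ← add_div]

/-- Only light pairs fluctuate. Their coefficients are at most 2KQ and at most `a e`, so the sum of
the squares is at most 2KQ times the number of triangles. -/
theorem sq_expect_abs_meanWeight_sub_le (hQ : 1 ≤ Q) (h01 : ∀ ω, ∀ e ∈ E, s ω e * s ω e = s ω e)
    (h1 : ∀ e ∈ E, 𝔼 ω, s ω e = 1 / Q)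
    (h2 : ∀ e ∈ E, ∀ e' ∈ E, e ≠ e' → 𝔼 ω, s ω e * s ω e' ≤ 1 / (Q : ℝ) ^ 2) :
    (𝔼 ω, |∑ e ∈ E, meanWeight Q K a k e - ∑ e ∈ E, weight Q K a k (s ω) e|) ^ 2
      ≤ (Q - 1) * (2 * K * Q) * ∑ e ∈ E, (a e : ℝ) := by
  have hQ1 : (1 : ℝ) ≤ Q := by exact_mod_cast hQ
  refine (sq_expect_le _).trans ?_
  set c : ι → ℝ := fun e => if K ≤ k e then 0 else reportable Q K a k e with hc
  have hc0 : ∀ e, 0 ≤ c e := fun e => by simp only [hc]; split_ifs <;> positivity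
  have hdiff : ∀ ω, |∑ e ∈ E, meanWeight Q K a k e - ∑ e ∈ E, weight Q K a k (s ω) e| ^ 2
      = (∑ e ∈ E, c e * (Q * s ω e - 1)) ^ 2 := by
    intro ω
    rw [sq_abs, ← sum_sub_distrib, ← neg_sq, ← sum_neg_distrib]
    congr 1
    refine sum_congr rfl fun e _ => ?_
    simp only [meanWeight, weight, hc]
    split_ifs <;> ring
  simp_rw [hdiff]
  refine (expect_sq_sum_le E c (fun e _ => hc0 e) s Q hQ1 h01 h1 h2).trans ?_
  rw [mul_assoc]
  refine mul_le_mul_of_nonneg_left ?_ (by linarith)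
  rw [mul_sum]
  refine sum_le_sum fun e _ => ?_
  simp only [hc]
  split_ifs with h
  · rw [zero_pow two_ne_zero]; positivity
  · rw [sq]
    have h3 : (reportable Q K a k e : ℝ) ≤ a e := by exact_mod_cast min_le_left _ _
    have h4 : (reportable Q K a k e : ℝ) ≤ 2 * K * Q := by
      have : reportable Q K a k e ≤ 2 * K * Q := by
        rw [reportable, cutoff, if_neg h]; exact min_le_right _ _
      exact_mod_cast this
    exact mul_le_mul h4 h3 (by positivity) (by positivity)

end Scheme

end TriangleStream


namespace TriangleStream

open BigOperators Finset

/-! ### Averaging over both samples -/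

section Combined

variable {ι : Type*} {Q K : ℕ} {a k : ι → ℕ} {E : Finset ι}

/-- The cutoff equals 2Q·max(k, K), so triangles are lost only when `a e` exceeds both 2QK and 2Qk.
-/
theorem sub_reportable_le (e : ι) :
    (a e : ℝ) - reportable Q K a k e ≤ a e * if 2 * K * Q < a e then
      (if 2 * (Q : ℝ) * k e < a e then 1 else 0) else 0 := by
  rw [reportable, Nat.cast_min]
  by_cases h : a e ≤ cutoff Q K k e
  · have h' : (a e : ℝ) ≤ cutoff Q K k e := by exact_mod_cast h
    rw [min_eq_left h', sub_self]
    refine mul_nonneg (Nat.cast_nonneg _) ?_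
    split_ifs <;> norm_num
  · push Not at h
    have hK : 2 * K * Q < a e ∧ 2 * Q * k e < a e := by
      rw [cutoff] at h
      split_ifs at h with hk
      · have : 2 * K * Q ≤ 2 * k e * Q := by gcongr
        exact ⟨by omega, by linarith⟩
      · push Not at hk
        have : 2 * k e * Q ≤ 2 * K * Q := by gcongr
        exact ⟨h, by linarith⟩
    have h2 : 2 * (Q : ℝ) * k e < a e := by exact_mod_cast hK.2
    rw [if_pos hK.1, if_pos h2, mul_one]
    have : (0 : ℝ) ≤ min (a e : ℝ) (cutoff Q K k e) := by positivity
    linarith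

theorem sum_meanWeight_le : ∑ e ∈ E, meanWeight Q K a k e
    ≤ 2 * ∑ e ∈ E, (Q : ℝ) * k e + ∑ e ∈ E, (a e : ℝ) := by
  rw [mul_sum, ← sum_add_distrib]
  refine sum_le_sum fun e _ => ?_
  rw [meanWeight]
  split_ifs
  · have : (0 : ℝ) ≤ a e := by positivity
    linarith
  · have h3 : (reportable Q K a k e : ℝ) ≤ a e := by exact_mod_cast min_le_left _ _
    have : (0 : ℝ) ≤ 2 * (Q * k e) := by positivity
    linarith

theorem sum_reportable_le_sum_meanWeight :
    ∑ e ∈ E, (reportable Q K a k e : ℝ) ≤ ∑ e ∈ E, meanWeight Q K a k e := by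
  refine sum_le_sum fun e _ => ?_
  rw [meanWeight]
  split_ifs with h
  · have : reportable Q K a k e ≤ 2 * k e * Q := by
      rw [reportable, cutoff, if_pos h]; exact min_le_right _ _
    exact_mod_cast this
  · exact le_rfl

variable {Ω₁ Ω₂ : Type*} [Fintype Ω₁] [Nonempty Ω₁] [Fintype Ω₂] [Nonempty Ω₂]
  {w : Ω₁ → ι → ℕ} {s : Ω₂ → ι → ℝ}

/-- All triangles are reported with about the same probability. -/
theorem exists_sum_abs_expect_reportProb_sub_le {δ : ℝ} (hδ : 0 ≤ δ) (hQ : 1 ≤ Q) (hK : 16 ≤ K)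
    (ht : 0 < ∑ e ∈ E, (a e : ℝ))
    (hδQ : ((Q : ℝ) - 1) * (2 * K * Q) ≤ δ ^ 2 * ∑ e ∈ E, (a e : ℝ))
    (hw : ∀ e ∈ E, 2 * K * Q < a e →
      𝔼 ω, (if 2 * (Q : ℝ) * w ω e < a e then (1 : ℝ) else 0) ≤ 4 * Q / a e)
    (hw' : 𝔼 ω, ∑ e ∈ E, (Q : ℝ) * w ω e ≤ 3 * ∑ e ∈ E, (a e : ℝ))
    (h01 : ∀ ω, ∀ e ∈ E, s ω e * s ω e = s ω e) (hs : ∀ ω, ∀ e ∈ E, 0 ≤ s ω e)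
    (h1 : ∀ e ∈ E, 𝔼 ω, s ω e = 1 / Q)
    (h2 : ∀ e ∈ E, ∀ e' ∈ E, e ≠ e' → 𝔼 ω, s ω e * s ω e' ≤ 1 / (Q : ℝ) ^ 2) :
    ∃ c : ℝ, 1 / (56 * ∑ e ∈ E, (a e : ℝ)) ≤ c ∧
      ∑ e ∈ E, ∑ j ∈ range (a e),
        |𝔼 ω₁, 𝔼 ω₂, reportProb Q K a (w ω₁) E (s ω₂) e j - c| ≤ 4 / K + 2 * δ := by
  classical
  set t := ∑ e ∈ E, (a e : ℝ) with ht_def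
  have hK0 : (0 : ℝ) < K := by positivity
  have hQ0 : (0 : ℝ) < Q := by positivity
  set B : Ω₁ → ℝ := fun ω => ∑ e ∈ E, ((a e : ℝ) - reportable Q K a (w ω) e) with hB
  set W : Ω₁ → ℝ := fun ω => ∑ e ∈ E, meanWeight Q K a (w ω) e with hW
  have hB0 : ∀ ω, 0 ≤ B ω := fun ω => sum_nonneg fun e _ => by
    have h3 : (reportable Q K a (w ω) e : ℝ) ≤ a e := by exact_mod_cast min_le_left _ _
    linarith
  have hBW : ∀ ω, t - B ω ≤ W ω := fun ω => by
    have := sum_reportable_le_sum_meanWeight (Q := Q) (K := K) (a := a) (k := w ω) (E := E)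
    simp only [hB, sum_sub_distrib]
    linarith
  have hW0 : ∀ ω, 0 ≤ W ω := fun ω => sum_nonneg fun e _ => by
    rw [meanWeight]; split_ifs <;> positivity
  -- Chebyshev bounds the mean loss at a pair by a·4Q/a = 4Q, which is at most 2a/K because a > 2KQ.
  have hEB : 𝔼 ω, B ω ≤ 2 / K * t := by
    simp only [hB]
    rw [expect_sum_comm, mul_sum]
    refine sum_le_sum fun e he => ?_
    refine (expect_le_expect fun ω _ => sub_reportable_le e).trans ?_
    rw [← mul_expect]
    split_ifs with h
    · have ha : (0 : ℝ) < a e := by exact_mod_cast (Nat.zero_le _).trans_lt h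
      refine (mul_le_mul_of_nonneg_left (hw e he h) ha.le).trans ?_
      rw [mul_div_cancel₀ _ ha.ne', div_mul_eq_mul_div, le_div_iff₀ hK0]
      have : (2 * K * Q : ℝ) < a e := by exact_mod_cast h
      nlinarith
    · simp only [expect_const_zero, mul_zero]; positivity
  -- Here 7 = 2·3 + 1: heavy items from the witnesses, light items from the triangles.
  have hEW : 𝔼 ω, W ω ≤ 7 * t := by
    calc 𝔼 ω, W ω ≤ 𝔼 ω, (2 * ∑ e ∈ E, (Q : ℝ) * w ω e + t) :=
          expect_le_expect fun ω _ => sum_meanWeight_le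
      _ = 2 * 𝔼 ω, ∑ e ∈ E, (Q : ℝ) * w ω e + t := by
          rw [expect_add_distrib, ← mul_expect, Fintype.expect_const]
      _ ≤ 7 * t := by linarith
  -- The target probability given the first sample, set to 0 if more than half of the triangles are
  -- lost; otherwise W ≥ t/2.
  set c : Ω₁ → ℝ := fun ω => if 2 * B ω ≤ t then 1 / W ω else 0 with hc
  -- Markov's inequality for two bad events in one pointwise bound: on average W/(28t) is at most
  -- 1/4, and 2B/t is at most 1/4 since K ≥ 16, which leaves 1/(56t).
  have hc_lower : ∀ ω, 1 / (28 * t) * (1 - 2 * B ω / t - W ω / (28 * t)) ≤ c ω := by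
    intro ω
    have h3 : 0 ≤ 2 * B ω / t := div_nonneg (mul_nonneg zero_le_two (hB0 ω)) ht.le
    have h4 : 0 ≤ W ω / (28 * t) := div_nonneg (hW0 ω) (by positivity)
    have h28 : 0 < 1 / (28 * t) := by positivity
    simp only [hc]
    split_ifs with h
    · have hWpos : 0 < W ω := by linarith [hBW ω]
      by_cases h5 : W ω ≤ 28 * t
      · calc 1 / (28 * t) * (1 - 2 * B ω / t - W ω / (28 * t)) ≤ 1 / (28 * t) * 1 :=
              mul_le_mul_of_nonneg_left (by linarith) h28.le
          _ ≤ 1 / W ω := by rw [mul_one]; exact one_div_le_one_div_of_le hWpos h5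
      · push Not at h5
        have : 1 ≤ W ω / (28 * t) := by rw [le_div_iff₀ (by positivity)]; linarith
        exact (mul_nonpos_of_nonneg_of_nonpos h28.le (by linarith)).trans (by positivity)
    · push Not at h
      have : 1 ≤ 2 * B ω / t := by rw [le_div_iff₀ ht]; linarith
      exact mul_nonpos_of_nonneg_of_nonpos h28.le (by linarith)
  refine ⟨𝔼 ω, c ω, ?_, ?_⟩
  · calc 1 / (56 * t) = 1 / (28 * t) * (1 - 1 / 4 - 7 * t / (28 * t)) := by
          field_simp; norm_num
      _ ≤ 1 / (28 * t) * (1 - 2 * (𝔼 ω, B ω) / t - (𝔼 ω, W ω) / (28 * t)) := by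
          refine mul_le_mul_of_nonneg_left ?_ (by positivity)
          have h5 : 2 * (𝔼 ω, B ω) / t ≤ 1 / 4 := by
            rw [div_le_iff₀ ht]
            have : 2 / (K : ℝ) ≤ 1 / 8 := by
              rw [div_le_div_iff₀ hK0 (by norm_num)]
              have : (16 : ℝ) ≤ K := by exact_mod_cast hK
              linarith
            nlinarith
          have h6 : (𝔼 ω, W ω) / (28 * t) ≤ 7 * t / (28 * t) := by gcongr
          linarith
      _ = 𝔼 ω, 1 / (28 * t) * (1 - 2 * B ω / t - W ω / (28 * t)) := by
          rw [← mul_expect, expect_sub_distrib, expect_sub_distrib, Fintype.expect_const,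
            ← expect_div, ← expect_div, ← mul_expect]
      _ ≤ 𝔼 ω, c ω := expect_le_expect fun ω _ => hc_lower ω
  · have hω : ∀ ω, ∑ e ∈ E, ∑ j ∈ range (a e),
        |𝔼 ω₂, reportProb Q K a (w ω) E (s ω₂) e j - c ω| ≤ 2 * B ω / t + 2 * δ := by
      intro ω
      simp only [hc]
      split_ifs with h
      · have hWt : t ≤ 2 * W ω := by linarith [hBW ω]
        have hWpos : 0 < W ω := by linarith
        refine (sum_abs_expect_reportProb_sub_le hQ hs h1 hWpos).trans ?_
        set D := 𝔼 ω₂, |W ω - ∑ e ∈ E, weight Q K a (w ω) (s ω₂) e| with hD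
        have hD0 : 0 ≤ D := expect_nonneg fun _ _ => abs_nonneg _
        have hDsq : D ^ 2 ≤ (δ * t) ^ 2 := by
          have := sq_expect_abs_meanWeight_sub_le (K := K) (a := a) (k := w ω) hQ h01 h1 h2
          exact (this.trans (mul_le_mul_of_nonneg_right hδQ ht.le)).trans_eq (by ring)
        have hDle : D ≤ δ * t := abs_le_of_sq_le_sq' hDsq (by positivity) |>.2
        change (B ω + D) / W ω ≤ _
        rw [div_le_iff₀ hWpos]
        have h7 : 2 * B ω / t * W ω ≥ B ω := by
          rw [ge_iff_le, div_mul_eq_mul_div, le_div_iff₀ ht]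
          nlinarith [hB0 ω]
        nlinarith
      · push Not at h
        -- For such a first sample the report probabilities sum to at most 1, which 2B/t absorbs.
        have h8 : 1 ≤ 2 * B ω / t := by rw [le_div_iff₀ ht]; linarith
        have h9 : ∑ e ∈ E, ∑ j ∈ range (a e),
            |𝔼 ω₂, reportProb Q K a (w ω) E (s ω₂) e j - 0| ≤ 1 := by
          calc _ = ∑ e ∈ E, ∑ j ∈ range (a e), 𝔼 ω₂, reportProb Q K a (w ω) E (s ω₂) e j := by
                refine sum_congr rfl fun e he => sum_congr rfl fun j _ => ?_
                rw [sub_zero, abs_of_nonneg]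
                exact expect_nonneg fun ω₂ _ => reportProb_nonneg (hs ω₂) he j
            _ = 𝔼 ω₂, ∑ e ∈ E, ∑ j ∈ range (a e), reportProb Q K a (w ω) E (s ω₂) e j := by
                simp_rw [expect_sum_comm]
            _ ≤ 1 := expect_le univ_nonempty fun ω₂ _ => sum_reportProb_le_one (hs ω₂)
        linarith
    calc ∑ e ∈ E, ∑ j ∈ range (a e),
          |𝔼 ω₁, 𝔼 ω₂, reportProb Q K a (w ω₁) E (s ω₂) e j - 𝔼 ω, c ω|
        ≤ ∑ e ∈ E, ∑ j ∈ range (a e), 𝔼 ω₁,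
          |𝔼 ω₂, reportProb Q K a (w ω₁) E (s ω₂) e j - c ω₁| := by
          refine sum_le_sum fun e _ => sum_le_sum fun j _ => ?_
          rw [← expect_sub_distrib]
          exact abs_expect_le _ _
      _ = 𝔼 ω₁, ∑ e ∈ E, ∑ j ∈ range (a e),
          |𝔼 ω₂, reportProb Q K a (w ω₁) E (s ω₂) e j - c ω₁| := by
          simp_rw [expect_sum_comm]
      _ ≤ 𝔼 ω₁, (2 * B ω₁ / t + 2 * δ) := expect_le_expect fun ω _ => hω ω
      _ = 2 * (𝔼 ω, B ω) / t + 2 * δ := by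
          rw [expect_add_distrib, ← expect_div, ← mul_expect, Fintype.expect_const]
      _ ≤ 4 / K + 2 * δ := by
          have : 2 * (𝔼 ω, B ω) / t ≤ 4 / K := by
            rw [div_le_iff₀ ht]
            calc 2 * 𝔼 ω, B ω ≤ 2 * (2 / K * t) := by linarith
              _ = 4 / K * t := by ring
          linarith

/-- Normalizing nearly equal probabilities gives a nearly uniform distribution. -/
theorem sum_abs_div_sub_le {τ : Type*} (T : Finset τ) (p : τ → ℝ) {c ε θ : ℝ} (hT : T.Nonempty)
    (hc : 1 / (56 * (T.card : ℝ)) ≤ c) (hθ : θ ≤ ε / 400) (hε : ε < 2)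
    (h : ∑ i ∈ T, |p i - c| ≤ θ) :
    1 / 80 ≤ ∑ i ∈ T, p i ∧ ∑ i ∈ T, |p i / (∑ i ∈ T, p i) - 1 / T.card| ≤ ε := by
  have hN : (0 : ℝ) < T.card := by exact_mod_cast hT.card_pos
  set s := ∑ i ∈ T, p i with hs
  have hsc : |s - T.card * c| ≤ θ := by
    have : s - T.card * c = ∑ i ∈ T, (p i - c) := by simp [sum_sub_distrib, hs]
    rw [this]
    exact (abs_sum_le_sum_abs _ _).trans h
  have hc' : 1 / 56 ≤ T.card * c := by
    have := mul_le_mul_of_nonneg_left hc hN.le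
    refine le_trans (le_of_eq ?_) this
    field_simp
  -- θ ≤ ε/400 < 1/200, and 1/56 - 1/200 > 1/80.
  have hs80 : 1 / 80 ≤ s := by
    have := (abs_le.1 hsc).1
    linarith
  refine ⟨hs80, ?_⟩
  have hs0 : 0 < s := by linarith
  calc ∑ i ∈ T, |p i / s - 1 / T.card|
      ≤ ∑ i ∈ T, (|p i - c| / s + |s - T.card * c| / (T.card * s)) := by
        refine sum_le_sum fun i _ => ?_
        have : p i / s - 1 / T.card = (p i - c) / s - (s - T.card * c) / (T.card * s) := by
          field_simp; ring
        rw [this]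
        refine (abs_sub _ _).trans (le_of_eq ?_)
        rw [abs_div, abs_div, abs_of_pos hs0, abs_of_pos (mul_pos hN hs0)]
    _ = (∑ i ∈ T, |p i - c|) / s + |s - T.card * c| / s := by
        rw [sum_add_distrib, ← sum_div, sum_const, nsmul_eq_mul]
        congr 1
        field_simp
    _ ≤ θ / s + θ / s := by gcongr
    _ ≤ ε := by
        rw [← add_div, div_le_iff₀ hs0]
        have hθ0 : 0 ≤ θ := (abs_nonneg _).trans hsc
        nlinarith

end Combined

end TriangleStream


namespace TriangleStream

open BigOperators Finset

/-! ### The stream of a graph -/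

section Order

variable {V : Type} [DecidableEq V] {P : List V}

theorem mem_after_iff (hP : P.Nodup) {x y : V} :
    y ∈ after P x ↔ y ∈ P ∧ P.idxOf x < P.idxOf y := by
  rw [after, List.mem_drop_iff_getElem]
  constructor
  · rintro ⟨j, hj, rfl⟩
    refine ⟨List.getElem_mem _, ?_⟩
    rw [hP.idxOf_getElem]
    omega
  · rintro ⟨hy, hlt⟩
    have hl := List.idxOf_lt_length_of_mem hy
    refine ⟨P.idxOf y - (P.idxOf x + 1), by omega, ?_⟩
    have : P.idxOf x + 1 + (P.idxOf y - (P.idxOf x + 1)) = P.idxOf y := by omega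
    simp only [this, List.getElem_idxOf]

theorem nodup_after (hP : P.Nodup) (x : V) : (after P x).Nodup := hP.sublist (List.drop_sublist _ _)

theorem nodup_apexes (nb : V → List V) (hP : P.Nodup) (x y : V) : (apexes nb P x y).Nodup :=
  (nodup_after hP y).filter _

end Order

/-- The neighbour lists `nb` describe a simple graph whose vertices of positive degree are listed
in `P`. -/
structure IsVertexOrder {n : ℕ} (nb : Fin n → List (Fin n)) (P : List (Fin n)) : Prop where
  nodup : P.Nodup
  nodup_nb : ∀ v, (nb v).Nodup
  symm : ∀ {x y}, x ∈ nb y → y ∈ nb x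
  irrefl : ∀ v, v ∉ nb v
  mem_iff : ∀ v, v ∈ P ↔ nb v ≠ []

namespace IsVertexOrder

variable {n : ℕ} {nb : Fin n → List (Fin n)} {P : List (Fin n)}

theorem mem_of_mem (h : IsVertexOrder nb P) {x y : Fin n} (hx : x ∈ nb y) : y ∈ P :=
  (h.mem_iff y).2 (List.ne_nil_of_mem hx)

theorem nodup_vertexStream (h : IsVertexOrder nb P) : (vertexStream nb P).Nodup := by
  rw [vertexStream, List.nodup_flatMap]
  refine ⟨fun v _ => (h.nodup_nb v).map (Prod.mk_right_injective v), ?_⟩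
  refine h.nodup.imp fun {u v} huv => ?_
  rw [Function.onFun, List.disjoint_left]
  intro p hp hp'
  obtain ⟨w, _, rfl⟩ := List.mem_map.1 hp
  obtain ⟨w', _, heq⟩ := List.mem_map.1 hp'
  exact huv (congrArg Prod.fst heq).symm

theorem mem_vertexStream (h : IsVertexOrder nb P) {v w : Fin n} (hw : w ∈ nb v) :
    (v, w) ∈ vertexStream nb P :=
  List.mem_flatMap.2 ⟨v, h.mem_of_mem hw, List.mem_map.2 ⟨w, hw, rfl⟩⟩

/-- No token repeats, so sampling positions of the stream is the same as sampling tokens. -/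
theorem idxOf_vertexStream (h : IsVertexOrder nb P) {P' : List (Fin n)} {v : Fin n}
    (hv : P' ++ [v] <+: P) {i : ℕ} (hi : i < (nb v).length) :
    (vertexStream nb P).idxOf (v, (nb v)[i]) = (vertexStream nb P').length + i := by
  obtain ⟨R, hR⟩ := hv
  have hs : vertexStream nb P
      = vertexStream nb P' ++ ((nb v).map (Prod.mk v) ++ vertexStream nb R) := by
    rw [← hR]; simp [vertexStream]
  have hlt : (vertexStream nb P').length + i < (vertexStream nb P).length := by
    rw [hs]; simp; omega
  have hget : (vertexStream nb P)[(vertexStream nb P').length + i] = (v, (nb v)[i]) := by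
    simp only [hs]
    rw [List.getElem_append_right (by omega), List.getElem_append_left (by simpa using hi)]
    simp
  rw [← hget, h.nodup_vertexStream.idxOf_getElem]

/-- The adjacent pairs, in the order of their appearance in `P`. -/
def pairs (nb : Fin n → List (Fin n)) (P : List (Fin n)) : Finset (Fin n × Fin n) :=
  univ.filter fun e => e.2 ∈ after P e.1 ∧ e.1 ∈ nb e.2

theorem sum_items (h : IsVertexOrder nb P) {Q K : ℕ} (hK : 1 ≤ K) (s₁ s₂ : ℕ → Bool)
    {f₁ f₂ : Fin n → Fin n → Bool}
    (hf₁ : ∀ v w, f₁ v w = s₁ ((vertexStream nb P).idxOf (v, w)))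
    (hf₂ : ∀ v w, f₂ v w = s₂ ((vertexStream nb P).idxOf (v, w))) (F : Item (Fin n) → ℕ) :
    (((triangleProcess n Q K s₁ s₂).items (vertexStream nb P)).map F).sum
      = ∑ e ∈ pairs nb P, if K ≤ witnesses nb f₁ e.1 e.2 then
          ∑ j ∈ range (2 * witnesses nb f₁ e.1 e.2 * Q), F (watched nb P e.1 e.2 j)
        else if f₂ e.1 e.2 then
          Q * (((apexes nb P e.1 e.2).take (2 * K * Q)).map fun z => F (Item.tri e.1 e.2 z)).sum
        else 0 := by
  have hfull := (full_vertexStream (Q := Q) (s₁ := s₁) (s₂ := s₂) (f₁ := f₁) (f₂ := f₂) hK h.irrefl h.nodup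
    (fun v hv => (h.mem_iff v).1 hv)
    (fun P' v hv i hi => by rw [hf₁, h.idxOf_vertexStream hv hi])
    (fun P' v hv i hi => by rw [hf₂, h.idxOf_vertexStream hv hi]) rfl).2.2 F
  rw [items_eq, hfull]
  have hheavy : ∑ x, heavySum nb f₁ Q K P F x = ∑ e ∈ pairs nb P,
      if K ≤ witnesses nb f₁ e.1 e.2 then
        ∑ j ∈ range (2 * witnesses nb f₁ e.1 e.2 * Q), F (watched nb P e.1 e.2 j) else 0 := by
    rw [pairs, sum_filter, ← univ_product_univ, sum_product]
    refine sum_congr rfl fun x _ => ?_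
    have hset : (after P x).toFinset = univ.filter (· ∈ after P x) := by ext; simp
    rw [heavySum, ← List.sum_toFinset _ (nodup_after h.nodup x), hset, sum_filter]
    refine sum_congr rfl fun y _ => ?_
    by_cases hy : y ∈ after P x
    · by_cases hx : x ∈ nb y
      · simp only [hy, hx, and_self, if_true]
        rw [← List.sum_toFinset _ List.nodup_range, List.toFinset_range]
      · have : ¬ K ≤ witnesses nb f₁ x y := by rw [witnesses, if_neg hx]; omega
        simp [hx, this]
    · simp [hy]
  have hlight : (P.map (lightSum nb f₁ f₂ Q K P F)).sum = ∑ e ∈ pairs nb P,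
      if K ≤ witnesses nb f₁ e.1 e.2 then 0 else if f₂ e.1 e.2 then
        Q * (((apexes nb P e.1 e.2).take (2 * K * Q)).map fun z => F (Item.tri e.1 e.2 z)).sum
        else 0 := by
    rw [pairs, sum_filter, ← univ_product_univ, sum_product, ← List.sum_toFinset _ h.nodup]
    have hset : P.toFinset = univ.filter (· ∈ P) := by ext; simp
    rw [hset, sum_filter]
    refine sum_congr rfl fun x _ => ?_
    by_cases hx : x ∈ P
    · rw [if_pos hx, lightSum, ← List.sum_toFinset _ ((h.nodup_nb x).filter _)]
      have hset' : ((nb x).filter (f₂ x)).toFinset = univ.filter fun w => w ∈ nb x ∧ f₂ x w := by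
        ext; simp
      rw [hset', sum_filter]
      refine sum_congr rfl fun w _ => ?_
      have hsymm : w ∈ nb x ↔ x ∈ nb w := ⟨h.symm, h.symm⟩
      simp only [kept, hsymm, ← not_le]
      by_cases h1 : w ∈ after P x <;> by_cases h2 : x ∈ nb w <;> by_cases h3 : f₂ x w <;>
        by_cases h4 : K ≤ witnesses nb f₁ x w <;> simp [h1, h2, h3, h4]
    · simp [hx, after_of_notMem hx]
  rw [hheavy, hlight, ← sum_add_distrib]
  refine sum_congr rfl fun e _ => ?_
  split_ifs <;> simp

end IsVertexOrder

end TriangleStream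


namespace TriangleStream

open BigOperators Finset

/-! ### Charging triangles to pairs, and their report probabilities -/

theorem mem_apexes {V : Type} [DecidableEq V] {nb : V → List V} {P : List V} {x y z : V} :
    z ∈ apexes nb P x y ↔ z ∈ after P y ∧ x ∈ nb z ∧ y ∈ nb z := by
  simp [apexes]

/-- The `j`-th triangle charged to the pair `e`. -/
def triangleAt {n : ℕ} (nb : Fin n → List (Fin n)) (P : List (Fin n)) (e : Fin n × Fin n) (j : ℕ) :
    Finset (Fin n) :=
  {e.1, e.2, (apexes nb P e.1 e.2).getD j e.1}

/-- The number of triangles charged to the pair `e`. -/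
def charge {n : ℕ} (nb : Fin n → List (Fin n)) (P : List (Fin n)) (e : Fin n × Fin n) : ℕ :=
  (apexes nb P e.1 e.2).length

theorem sum_map_ite_eq_countP {α : Type} (l : List α) (p : α → Bool) :
    (l.map fun i => if p i then 1 else 0).sum = l.countP p := by
  induction l with
  | nil => rfl
  | cons a l ih => rw [List.map_cons, List.sum_cons, ih, List.countP_cons, add_comm]

theorem sum_map_take_ite_eq {α : Type} [DecidableEq α] {l : List α} (hl : l.Nodup) {j : ℕ}
    (hj : j < l.length) (c : ℕ) :
    ((l.take c).map fun z => if z = l[j] then 1 else 0).sum = if j < c then 1 else 0 := by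
  have h1 : ((l.take c).map fun z => if z = l[j] then 1 else 0).sum = (l.take c).count l[j] := by
    rw [List.count, ← sum_map_ite_eq_countP]
    simp
  rw [h1]
  split_ifs with h
  · refine List.count_eq_one_of_mem (hl.sublist (List.take_sublist _ _)) ?_
    exact List.mem_take_iff_getElem.2 ⟨j, by omega, rfl⟩
  · refine List.count_eq_zero_of_not_mem fun hmem => h ?_
    obtain ⟨i, hi, heq⟩ := List.mem_take_iff_getElem.1 hmem
    rw [hl.getElem_inj_iff] at heq
    omega

namespace IsVertexOrder

variable {n : ℕ} {nb : Fin n → List (Fin n)} {P : List (Fin n)}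

theorem mem_pairs {e : Fin n × Fin n} : e ∈ pairs nb P ↔ e.2 ∈ after P e.1 ∧ e.1 ∈ nb e.2 := by
  simp [pairs]

/-- Sorting the three vertices by position in `P` recovers the triple from the set, so each triangle
is charged only once. -/
theorem eq_of_insert_eq (h : IsVertexOrder nb P) {x y z x' y' z' : Fin n}
    (hxy : y ∈ after P x) (hyz : z ∈ after P y) (hxy' : y' ∈ after P x') (hyz' : z' ∈ after P y')
    (heq : ({x, y, z} : Finset (Fin n)) = {x', y', z'}) : x = x' ∧ y = y' ∧ z = z' := by
  have hx := left_mem_of_mem_after hxy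
  have hy := mem_of_mem_after hxy
  have hz := mem_of_mem_after hyz
  rw [mem_after_iff h.nodup] at hxy hyz hxy' hyz'
  have e1 : x ∈ ({x', y', z'} : Finset (Fin n)) := heq ▸ by simp
  have e2 : y ∈ ({x', y', z'} : Finset (Fin n)) := heq ▸ by simp
  have e3 : z ∈ ({x', y', z'} : Finset (Fin n)) := heq ▸ by simp
  simp only [Finset.mem_insert, Finset.mem_singleton] at e1 e2 e3
  have key : ∀ u : Fin n, u = x' ∨ u = y' ∨ u = z' →
      P.idxOf u = P.idxOf x' ∨ P.idxOf u = P.idxOf y' ∨ P.idxOf u = P.idxOf z' := by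
    rintro u (rfl | rfl | rfl) <;> simp
  have k1 := key x e1
  have k2 := key y e2
  have k3 := key z e3
  rw [← List.idxOf_inj hx, ← List.idxOf_inj hy, ← List.idxOf_inj hz]
  omega

theorem eq_of_triangleAt_eq (h : IsVertexOrder nb P) {e e' : Fin n × Fin n} {j j' : ℕ}
    (he : e ∈ pairs nb P) (he' : e' ∈ pairs nb P) (hj : j < charge nb P e) (hj' : j' < charge nb P e')
    (heq : triangleAt nb P e j = triangleAt nb P e' j') : e = e' ∧ j = j' := by
  rw [charge] at hj hj'
  simp only [triangleAt, List.getD_eq_getElem _ _ hj, List.getD_eq_getElem _ _ hj'] at heq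
  obtain ⟨h1, h2, h3⟩ := h.eq_of_insert_eq (mem_pairs.1 he).1
    (mem_apexes.1 (List.getElem_mem hj)).1 (mem_pairs.1 he').1
    (mem_apexes.1 (List.getElem_mem hj')).1 heq
  obtain rfl := Prod.ext h1 h2
  exact ⟨rfl, ((nodup_apexes nb h.nodup _ _).getElem_inj_iff).1 h3⟩

theorem out_watched (e : Fin n × Fin n) (j : ℕ) :
    (watched nb P e.1 e.2 j).out
      = if j < charge nb P e then some (triangleAt nb P e j) else none := by
  rw [watched, charge, triangleAt]
  split_ifs with hj
  · rw [List.getElem?_eq_getElem hj, List.getD_eq_getElem _ _ hj]; rfl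
  · rw [List.getElem?_eq_none (by omega)]; rfl

variable {Q K : ℕ} {s₁ s₂ : ℕ → Bool} {f₁ f₂ : Fin n → Fin n → Bool}

/-- Of the items of a heavy pair only number j becomes this triangle; a sampled light pair produces
Q copies of it; no other pair produces it. -/
theorem countP_items (h : IsVertexOrder nb P) (hK : 1 ≤ K)
    (hf₁ : ∀ v w, f₁ v w = s₁ ((vertexStream nb P).idxOf (v, w)))
    (hf₂ : ∀ v w, f₂ v w = s₂ ((vertexStream nb P).idxOf (v, w)))
    {e : Fin n × Fin n} (he : e ∈ pairs nb P) {j : ℕ} (hj : j < charge nb P e)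
    (p : Item (Fin n) → Bool) (hp : ∀ i, p i = true ↔ i.out = some (triangleAt nb P e j)) :
    ((triangleProcess n Q K s₁ s₂).items (vertexStream nb P)).countP p
      = if j < cutoff Q K (fun e => witnesses nb f₁ e.1 e.2) e then
          if K ≤ witnesses nb f₁ e.1 e.2 then 1 else if f₂ e.1 e.2 then Q else 0
        else 0 := by
  have htri : ∀ e' ∈ pairs nb P, ∀ i (hi : i < charge nb P e'),
      p (Item.tri e'.1 e'.2 ((apexes nb P e'.1 e'.2)[i])) = decide (e' = e ∧ i = j) := by
    intro e' he' i hi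
    rw [Bool.eq_iff_iff, hp, decide_eq_true_eq]
    have : (Item.tri e'.1 e'.2 ((apexes nb P e'.1 e'.2)[i])).out = some (triangleAt nb P e' i) := by
      rw [triangleAt, List.getD_eq_getElem _ _ hi]; rfl
    rw [this, Option.some_inj]
    exact ⟨fun heq => h.eq_of_triangleAt_eq he' he hi hj heq, by rintro ⟨rfl, rfl⟩; rfl⟩
  have hwatched : ∀ e' ∈ pairs nb P, ∀ i, p (watched nb P e'.1 e'.2 i) = decide (e' = e ∧ i = j) := by
    intro e' he' i
    rw [Bool.eq_iff_iff, hp, out_watched, decide_eq_true_eq]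
    split_ifs with hi
    · rw [Option.some_inj]
      exact ⟨fun heq => h.eq_of_triangleAt_eq he' he hi hj heq, by rintro ⟨rfl, rfl⟩; rfl⟩
    · simp only [false_iff]
      rintro ⟨rfl, rfl⟩
      exact hi hj
  have hmem : ∀ e' ∈ pairs nb P, ∀ z ∈ apexes nb P e'.1 e'.2,
      p (Item.tri e'.1 e'.2 z) = decide (e' = e ∧ z = (apexes nb P e.1 e.2).getD j e.1) := by
    intro e' he' z hz
    obtain ⟨i, hi, rfl⟩ := List.mem_iff_getElem.1 hz
    rw [htri e' he' i hi]
    congr 1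
    rw [eq_iff_iff]
    refine and_congr_right fun hee => ?_
    subst hee
    have hj' : j < (apexes nb P e'.1 e'.2).length := hj
    rw [List.getD_eq_getElem _ _ hj', (nodup_apexes nb h.nodup _ _).getElem_inj_iff]
  rw [← sum_map_ite_eq_countP, h.sum_items hK s₁ s₂ hf₁ hf₂, sum_eq_single_of_mem e he]
  · rw [cutoff]
    by_cases hheavy : K ≤ witnesses nb f₁ e.1 e.2
    · simp only [hheavy, if_true, hwatched e he]
      simp
    · simp only [hheavy, if_false]
      by_cases hs : f₂ e.1 e.2
      · simp only [hs, if_true]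
        have hj' : j < (apexes nb P e.1 e.2).length := hj
        have : (((apexes nb P e.1 e.2).take (2 * K * Q)).map fun z =>
            if p (Item.tri e.1 e.2 z) = true then 1 else 0).sum
            = (((apexes nb P e.1 e.2).take (2 * K * Q)).map fun z =>
              if z = (apexes nb P e.1 e.2)[j] then 1 else 0).sum := by
          congr 1
          refine List.map_congr_left fun z hz => ?_
          rw [hmem e he z (List.mem_of_mem_take hz), List.getD_eq_getElem _ _ hj']
          simp
        rw [this, sum_map_take_ite_eq (nodup_apexes nb h.nodup _ _) hj']
        simp
      · simp [hs]
  · intro e' he' hne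
    have h1 : ∀ i, p (watched nb P e'.1 e'.2 i) = false := fun i => by
      rw [hwatched e' he']; simp [hne]
    split_ifs
    · simp [h1]
    · rw [List.map_congr_left (g := fun _ => 0)]
      · simp
      · intro z hz
        rw [hmem e' he' z (List.mem_of_mem_take hz)]
        simp [hne]
    · rfl

theorem length_items (h : IsVertexOrder nb P) (hK : 1 ≤ K)
    (hf₁ : ∀ v w, f₁ v w = s₁ ((vertexStream nb P).idxOf (v, w)))
    (hf₂ : ∀ v w, f₂ v w = s₂ ((vertexStream nb P).idxOf (v, w))) :
    (((triangleProcess n Q K s₁ s₂).items (vertexStream nb P)).length : ℝ)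
      = ∑ e ∈ pairs nb P, weight Q K (charge nb P) (fun e => witnesses nb f₁ e.1 e.2)
          (fun e => if f₂ e.1 e.2 then 1 else 0) e := by
  have h1 : ∀ l : List (Item (Fin n)), l.length = (l.map fun _ => 1).sum := fun l => by simp
  rw [h1, h.sum_items hK s₁ s₂ hf₁ hf₂, Nat.cast_sum]
  refine sum_congr rfl fun e _ => ?_
  rw [weight, reportable, cutoff, charge]
  split_ifs <;> simp [min_comm]

theorem countP_div_length_items (h : IsVertexOrder nb P) (hK : 1 ≤ K)
    (hf₁ : ∀ v w, f₁ v w = s₁ ((vertexStream nb P).idxOf (v, w)))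
    (hf₂ : ∀ v w, f₂ v w = s₂ ((vertexStream nb P).idxOf (v, w)))
    {e : Fin n × Fin n} (he : e ∈ pairs nb P) {j : ℕ} (hj : j < charge nb P e)
    (p : Item (Fin n) → Bool) (hp : ∀ i, p i = true ↔ i.out = some (triangleAt nb P e j)) :
    (((triangleProcess n Q K s₁ s₂).items (vertexStream nb P)).countP p : ℝ)
        / ((triangleProcess n Q K s₁ s₂).items (vertexStream nb P)).length
      = reportProb Q K (charge nb P) (fun e => witnesses nb f₁ e.1 e.2) (pairs nb P)
          (fun e => if f₂ e.1 e.2 then 1 else 0) e j := by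
  rw [h.countP_items hK hf₁ hf₂ he hj p hp, h.length_items hK hf₁ hf₂, reportProb]
  congr 1
  rw [multiplicity]
  split_ifs <;> simp

theorem output_triangleAt (h : IsVertexOrder nb P) [NeZero Q] (hK : 1 ≤ K) (l : ℕ)
    {e : Fin n × Fin n} (he : e ∈ pairs nb P) {j : ℕ} (hj : j < charge nb P e) :
    ((triangleSampler n Q K l).output (vertexStream nb P) (some (triangleAt nb P e j))).toReal
      = 𝔼 σ₁ : Seed Q l, 𝔼 σ₂ : Seed Q l, reportProb Q K (charge nb P)
          (fun e => witnesses nb (fun v w => σ₁.sampled ((vertexStream nb P).idxOf (v, w))) e.1 e.2)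
          (pairs nb P) (fun e => if σ₂.sampled ((vertexStream nb P).idxOf e) then 1 else 0) e j := by
  rw [triangleSampler, ItemProcess.sampler_output_some _ _ _ _
    (fun _ i => decide (i.out = some (triangleAt nb P e j))) fun _ _ => decide_eq_true_iff, ← univ_product_univ, expect_product]
  refine expect_congr rfl fun σ₁ _ => expect_congr rfl fun σ₂ _ => ?_
  exact h.countP_div_length_items hK (f₂ := fun v w => σ₂.sampled ((vertexStream nb P).idxOf (v, w)))
    (fun _ _ => rfl) (fun _ _ => rfl) he hj _ fun i => decide_eq_true_iff

end IsVertexOrder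

end TriangleStream


namespace TriangleStream

open BigOperators Finset

/-! ### Witness counts under random sampling -/

namespace IsVertexOrder

variable {n : ℕ} {nb : Fin n → List (Fin n)} {P : List (Fin n)}

/-- The common neighbours of the vertices of a pair. -/
def common (nb : Fin n → List (Fin n)) (e : Fin n × Fin n) : Finset (Fin n) :=
  (nb e.1).toFinset.filter (· ∈ nb e.2)

theorem mem_common {e : Fin n × Fin n} {z : Fin n} : z ∈ common nb e ↔ z ∈ nb e.1 ∧ z ∈ nb e.2 := by
  simp [common]

theorem cast_witnesses (h : IsVertexOrder nb P) (f : Fin n → Fin n → Bool) {e : Fin n × Fin n}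
    (he : e.1 ∈ nb e.2) :
    (witnesses nb f e.1 e.2 : ℝ) = ∑ z ∈ common nb e, if f e.1 z then 1 else 0 := by
  rw [witnesses, if_pos he, List.countP_eq_length_filter, List.filter_filter, sum_boole,
    ← List.toFinset_card_of_nodup ((h.nodup_nb _).filter _)]
  congr 2
  ext z
  simp [mem_common, and_assoc]

theorem apexes_subset_common (h : IsVertexOrder nb P) (e : Fin n × Fin n) :
    (apexes nb P e.1 e.2).toFinset ⊆ common nb e := by
  intro z hz
  rw [List.mem_toFinset, mem_apexes] at hz
  exact mem_common.2 ⟨h.symm hz.2.1, h.symm hz.2.2⟩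

theorem card_apexes (h : IsVertexOrder nb P) (e : Fin n × Fin n) :
    (apexes nb P e.1 e.2).toFinset.card = charge nb P e :=
  List.toFinset_card_of_nodup (nodup_apexes nb h.nodup _ _)

/-- A common neighbour of x < y lies after y, between them, or before x. In each case the three
vertices form a triangle with a known position of the pair in it, so every triangle is counted at
most three times. -/
theorem sum_card_common_le (h : IsVertexOrder nb P) :
    ∑ e ∈ pairs nb P, (common nb e).card ≤ 3 * ∑ e ∈ pairs nb P, charge nb P e := by
  set U := (pairs nb P).sigma fun e => common nb e with hU
  set T := (pairs nb P).sigma fun e => (apexes nb P e.1 e.2).toFinset with hT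
  have hUc : ∑ e ∈ pairs nb P, (common nb e).card = U.card := (card_sigma _ _).symm
  have hTc : ∑ e ∈ pairs nb P, charge nb P e = T.card := by
    rw [hT, card_sigma]
    exact sum_congr rfl fun e _ => (h.card_apexes e).symm
  rw [hUc, hTc]
  have hmemT : ∀ x y z : Fin n, y ∈ after P x → z ∈ after P y → x ∈ nb y → x ∈ nb z → y ∈ nb z →
      (⟨(x, y), z⟩ : (_ : Fin n × Fin n) × Fin n) ∈ T := by
    intro x y z h1 h2 h3 h4 h5
    rw [hT, mem_sigma, List.mem_toFinset]
    exact ⟨mem_pairs.2 ⟨h1, h3⟩, mem_apexes.2 ⟨h2, h4, h5⟩⟩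
  have hsub : U ⊆ T ∪ (T.image fun p => (⟨(p.1.1, p.2), p.1.2⟩ : (_ : Fin n × Fin n) × Fin n)) ∪
      (T.image fun p => (⟨(p.1.2, p.2), p.1.1⟩ : (_ : Fin n × Fin n) × Fin n)) := by
    rintro ⟨⟨x, y⟩, z⟩ hp
    obtain ⟨hp1, hp2⟩ := mem_sigma.1 hp
    obtain ⟨hxy, hxy'⟩ := mem_pairs.1 hp1
    obtain ⟨hzx, hzy⟩ := mem_common.1 hp2
    dsimp only at hxy hxy' hzx hzy
    have hx := left_mem_of_mem_after hxy
    have hy := mem_of_mem_after hxy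
    have hz := h.mem_of_mem (h.symm hzx)
    have hlt := ((mem_after_iff h.nodup).1 hxy).2
    have hnx : P.idxOf z ≠ P.idxOf x := by
      rw [Ne, List.idxOf_inj hz]; rintro rfl; exact h.irrefl _ hzx
    have hny : P.idxOf z ≠ P.idxOf y := by
      rw [Ne, List.idxOf_inj hz]; rintro rfl; exact h.irrefl _ hzy
    simp only [mem_union, mem_image]
    rcases lt_or_gt_of_ne hnx with h1 | h1
    · right
      exact ⟨⟨(z, x), y⟩, hmemT z x y ((mem_after_iff h.nodup).2 ⟨hx, h1⟩) hxy hzx hzy hxy', rfl⟩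
    · rcases lt_or_gt_of_ne hny with h2 | h2
      · left; right
        exact ⟨⟨(x, z), y⟩, hmemT x z y ((mem_after_iff h.nodup).2 ⟨hz, h1⟩)
          ((mem_after_iff h.nodup).2 ⟨hy, h2⟩) (h.symm hzx) hxy' hzy, rfl⟩
      · left; left
        exact hmemT x y z hxy ((mem_after_iff h.nodup).2 ⟨hz, h2⟩) hxy' (h.symm hzx) (h.symm hzy)
  calc U.card ≤ _ := card_le_card hsub
    _ ≤ T.card + T.card + T.card := (card_union_le _ _).trans
        (Nat.add_le_add ((card_union_le _ _).trans (Nat.add_le_add le_rfl card_image_le))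
          card_image_le)
    _ = 3 * T.card := by ring

section Sampling

variable {Q l : ℕ}

/-- The indicator function of the tokens that are sampled. -/
noncomputable def sampledTokens (nb : Fin n → List (Fin n)) (P : List (Fin n)) (σ : Seed Q l)
    (e : Fin n × Fin n) : ℝ :=
  if σ.sampled ((vertexStream nb P).idxOf e) then 1 else 0

theorem expect_sampledTokens [NeZero Q] (e : Fin n × Fin n) :
    𝔼 σ : Seed Q l, sampledTokens nb P σ e = 1 / Q := Seed.expect_sampled _

theorem expect_sampledTokens_mul_le [NeZero Q] (h : IsVertexOrder nb P)
    (hl : (vertexStream nb P).length ≤ 2 ^ l) {e e' : Fin n × Fin n} (he : e.2 ∈ nb e.1) (he' : e'.2 ∈ nb e'.1) (hne : e ≠ e') :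
    𝔼 σ : Seed Q l, sampledTokens nb P σ e * sampledTokens nb P σ e' ≤ 1 / (Q : ℝ) ^ 2 := by
  have h1 := h.mem_vertexStream he
  have h2 := h.mem_vertexStream he'
  refine Seed.expect_sampled_pair_le ?_ ((List.idxOf_lt_length_of_mem h1).trans_le hl)
    ((List.idxOf_lt_length_of_mem h2).trans_le hl)
  rwa [Ne, List.idxOf_inj h1]

theorem sampledTokens_mul_self (σ : Seed Q l) (e : Fin n × Fin n) :
    sampledTokens nb P σ e * sampledTokens nb P σ e = sampledTokens nb P σ e := by
  rw [sampledTokens]; split_ifs <;> norm_num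

theorem sampledTokens_nonneg (σ : Seed Q l) (e : Fin n × Fin n) :
    0 ≤ sampledTokens nb P σ e := by
  rw [sampledTokens]; split_ifs <;> norm_num

/-- The number of witnesses of `e` in the sample of tokens given by a seed. -/
def seedWitnesses (nb : Fin n → List (Fin n)) (P : List (Fin n)) (σ : Seed Q l)
    (e : Fin n × Fin n) : ℕ :=
  witnesses nb (fun v w => σ.sampled ((vertexStream nb P).idxOf (v, w))) e.1 e.2

theorem cast_seedWitnesses (h : IsVertexOrder nb P) (σ : Seed Q l) {e : Fin n × Fin n}
    (he : e.1 ∈ nb e.2) :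
    (seedWitnesses nb P σ e : ℝ) = ∑ z ∈ common nb e, sampledTokens nb P σ (e.1, z) :=
  h.cast_witnesses _ he

/-- Chebyshev is applied to the apexes alone; the remaining common neighbours can only add
witnesses. -/
theorem expect_seedWitnesses_lt_le [NeZero Q] (h : IsVertexOrder nb P)
    (hl : (vertexStream nb P).length ≤ 2 ^ l) {e : Fin n × Fin n} (he : e ∈ pairs nb P)
    (ha : 0 < charge nb P e) :
    𝔼 σ : Seed Q l, (if 2 * (Q : ℝ) * seedWitnesses nb P σ e < charge nb P e then (1 : ℝ) else 0)
      ≤ 4 * Q / charge nb P e := by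
  have hQ : (1 : ℝ) ≤ Q := by exact_mod_cast NeZero.one_le (n := Q)
  have hmem : ∀ z ∈ (apexes nb P e.1 e.2).toFinset, z ∈ nb e.1 := fun z hz =>
    (mem_common.1 (h.apexes_subset_common e hz)).1
  have := expect_sum_lt_half_le (apexes nb P e.1 e.2).toFinset
    (card_pos.1 (by rwa [h.card_apexes])) (fun (σ : Seed Q l) z => sampledTokens nb P σ (e.1, z)) Q hQ
    (fun σ z _ => sampledTokens_mul_self σ _) (fun z _ => expect_sampledTokens _)
    (fun z hz z' hz' hne => h.expect_sampledTokens_mul_le hl (hmem z hz) (hmem z' hz')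
      fun heq => hne (congrArg Prod.snd heq))
  rw [h.card_apexes] at this
  refine le_trans (expect_le_expect fun σ _ => ?_) this
  have hle : ∑ z ∈ (apexes nb P e.1 e.2).toFinset, sampledTokens nb P σ (e.1, z)
      ≤ seedWitnesses nb P σ e := by
    rw [h.cast_seedWitnesses σ (mem_pairs.1 he).2]
    exact sum_le_sum_of_subset_of_nonneg (h.apexes_subset_common e)
      fun z _ _ => sampledTokens_nonneg σ _
  split_ifs with h1 h2
  · exact le_rfl
  · exact absurd (lt_of_le_of_lt (mul_le_mul_of_nonneg_left hle (by positivity)) h1) h2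
  · exact zero_le_one
  · exact le_rfl

/-- Q times the number of witnesses has the number of common neighbours as its mean. -/
theorem expect_sum_seedWitnesses_le [NeZero Q] (h : IsVertexOrder nb P) :
    𝔼 σ : Seed Q l, ∑ e ∈ pairs nb P, (Q : ℝ) * seedWitnesses nb P σ e
      ≤ 3 * ∑ e ∈ pairs nb P, (charge nb P e : ℝ) := by
  have hQ : (Q : ℝ) ≠ 0 := Nat.cast_ne_zero.2 (NeZero.ne Q)
  calc 𝔼 σ : Seed Q l, ∑ e ∈ pairs nb P, (Q : ℝ) * seedWitnesses nb P σ e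
      = ∑ e ∈ pairs nb P, ((common nb e).card : ℝ) := by
        rw [expect_sum_comm]
        refine sum_congr rfl fun e he => ?_
        rw [← mul_expect]
        simp_rw [h.cast_seedWitnesses _ (mem_pairs.1 he).2]
        rw [expect_sum_comm]
        simp_rw [expect_sampledTokens]
        rw [sum_const, nsmul_eq_mul]
        field_simp
    _ ≤ _ := by exact_mod_cast h.sum_card_common_le

end Sampling

/-! ### Triangles -/

variable {G : SimpleGraph (Fin n)} [DecidableRel G.Adj]

theorem triangleAt_mem_triangles (hadj : ∀ v w, w ∈ nb v ↔ G.Adj v w) {e : Fin n × Fin n}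
    (he : e ∈ pairs nb P) {j : ℕ} (hj : j < charge nb P e) :
    triangleAt nb P e j ∈ triangles G := by
  rw [triangles, SimpleGraph.mem_cliqueFinset_iff, SimpleGraph.is3Clique_iff, triangleAt]
  rw [charge] at hj
  have hz := (mem_apexes.1 (List.getElem_mem hj)).2
  rw [hadj, hadj] at hz
  have he' := (mem_pairs.1 he).2
  rw [hadj] at he'
  rw [List.getD_eq_getElem _ _ hj]
  exact ⟨e.1, e.2, _, he'.symm, hz.1.symm, hz.2.symm, rfl⟩

theorem exists_triangleAt (h : IsVertexOrder nb P) (hadj : ∀ v w, w ∈ nb v ↔ G.Adj v w)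
    {Δ : Finset (Fin n)} (hΔ : Δ ∈ triangles G) :
    ∃ e ∈ pairs nb P, ∃ j < charge nb P e, triangleAt nb P e j = Δ := by
  have key : ∀ x y z : Fin n, G.Adj x y → G.Adj x z → G.Adj y z → P.idxOf x < P.idxOf y →
      P.idxOf y < P.idxOf z →
      ∃ e ∈ pairs nb P, ∃ j < charge nb P e, triangleAt nb P e j = {x, y, z} := by
    intro x y z hxy hxz hyz h1 h2
    have hy : y ∈ P := h.mem_of_mem ((hadj y x).2 hxy.symm)
    have hz : z ∈ P := h.mem_of_mem ((hadj z x).2 hxz.symm)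
    have hA : z ∈ apexes nb P x y := mem_apexes.2 ⟨(mem_after_iff h.nodup).2 ⟨hz, h2⟩,
      (hadj z x).2 hxz.symm, (hadj z y).2 hyz.symm⟩
    obtain ⟨j, hj, hjz⟩ := List.mem_iff_getElem.1 hA
    refine ⟨(x, y), mem_pairs.2 ⟨(mem_after_iff h.nodup).2 ⟨hy, h1⟩, (hadj y x).2 hxy.symm⟩,
      j, hj, ?_⟩
    rw [triangleAt, List.getD_eq_getElem _ _ hj, hjz]
  rw [triangles, SimpleGraph.mem_cliqueFinset_iff, SimpleGraph.is3Clique_iff] at hΔ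
  obtain ⟨x, y, z, hxy, hxz, hyz, rfl⟩ := hΔ
  have hne : ∀ {u v}, G.Adj u v → P.idxOf u ≠ P.idxOf v := by
    intro u v huv heq
    have hu : u ∈ P := h.mem_of_mem ((hadj u v).2 huv)
    rw [List.idxOf_inj hu] at heq
    exact huv.ne heq
  rcases lt_or_gt_of_ne (hne hxy) with a | a <;> rcases lt_or_gt_of_ne (hne hxz) with b | b <;>
    rcases lt_or_gt_of_ne (hne hyz) with c | c
  · exact key x y z hxy hxz hyz a c
  · convert key x z y hxz hxy hyz.symm b c using 7
    ext; simp; tauto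
  · omega
  · convert key z x y hxz.symm hyz.symm hxy b a using 7
    ext; simp; tauto
  · convert key y x z hxy.symm hyz hxz a b using 7
    ext; simp; tauto
  · omega
  · convert key y z x hyz hxy.symm hxz.symm c b using 7
    ext; simp; tauto
  · convert key z y x hyz.symm hxz.symm hxy.symm c a using 7
    ext; simp; tauto

theorem sum_triangles (h : IsVertexOrder nb P) (hadj : ∀ v w, w ∈ nb v ↔ G.Adj v w)
    (g : Finset (Fin n) → ℝ) :
    ∑ Δ ∈ triangles G, g Δ
      = ∑ e ∈ pairs nb P, ∑ j ∈ range (charge nb P e), g (triangleAt nb P e j) := by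
  rw [sum_sigma']
  symm
  refine sum_bij (fun p _ => triangleAt nb P p.1 p.2) ?_ ?_ ?_ (fun _ _ => rfl)
  · rintro ⟨e, j⟩ hp
    rw [mem_sigma, Finset.mem_range] at hp
    exact triangleAt_mem_triangles hadj hp.1 hp.2
  · rintro ⟨e, j⟩ hp ⟨e', j'⟩ hp' heq
    rw [mem_sigma, Finset.mem_range] at hp hp'
    obtain ⟨rfl, rfl⟩ := h.eq_of_triangleAt_eq hp.1 hp'.1 hp.2 hp'.2 heq
    rfl
  · intro Δ hΔ
    obtain ⟨e, he, j, hj, rfl⟩ := h.exists_triangleAt hadj hΔ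
    exact ⟨⟨e, j⟩, by simpa using ⟨he, hj⟩, rfl⟩

theorem card_triangles (h : IsVertexOrder nb P) (hadj : ∀ v w, w ∈ nb v ↔ G.Adj v w) :
    ((triangles G).card : ℝ) = ∑ e ∈ pairs nb P, (charge nb P e : ℝ) := by
  have := h.sum_triangles hadj fun _ => 1
  simpa using this

variable {Q K l : ℕ} [NeZero Q]

theorem output_of_notMem (h : IsVertexOrder nb P) (hadj : ∀ v w, w ∈ nb v ↔ G.Adj v w) (hK : 1 ≤ K)
    {Δ : Finset (Fin n)} (hΔ : Δ ∉ triangles G) :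
    (triangleSampler n Q K l).output (vertexStream nb P) (some Δ) = 0 := by
  have hne := PMF.apply_ne_top ((triangleSampler n Q K l).output (vertexStream nb P)) (some Δ)
  refine ((ENNReal.toReal_eq_zero_iff _).1 ?_).resolve_right hne
  rw [triangleSampler,
    ItemProcess.sampler_output_some _ _ _ _ (fun _ i => decide (i.out = some Δ))
      fun _ _ => decide_eq_true_iff]
  refine expect_eq_zero fun σ _ => ?_
  rw [← sum_map_ite_eq_countP, h.sum_items hK σ.1.sampled σ.2.sampled (f₁ := fun v w => σ.1.sampled
    ((vertexStream nb P).idxOf (v, w))) (f₂ := fun v w => σ.2.sampled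
    ((vertexStream nb P).idxOf (v, w))) (fun _ _ => rfl) (fun _ _ => rfl), sum_eq_zero]
  · simp
  · intro e he
    have h1 : ∀ j, ¬ (watched nb P e.1 e.2 j).out = some Δ := by
      intro j hj
      rw [out_watched] at hj
      split_ifs at hj with hlt
      exact hΔ (Option.some.inj hj ▸ triangleAt_mem_triangles hadj he hlt)
    split_ifs
    · simp [h1]
    · rw [List.map_congr_left (g := fun _ => 0)]
      · simp
      · intro z hz
        obtain ⟨j, hj, rfl⟩ := List.mem_iff_getElem.1 (List.mem_of_mem_take hz)
        have := h1 j
        rw [watched, List.getElem?_eq_getElem hj] at this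
        simpa using this
    · rfl

theorem output_close_to_uniform (h : IsVertexOrder nb P) (hadj : ∀ v w, w ∈ nb v ↔ G.Adj v w)
    (hl : (vertexStream nb P).length ≤ 2 ^ l) {δ ε : ℝ} (hδ : 0 ≤ δ) (hK : 16 ≤ K)
    (ht : (triangles G).Nonempty)
    (hδQ : ((Q : ℝ) - 1) * (2 * K * Q) ≤ δ ^ 2 * (triangles G).card)
    (hε : 4 / K + 2 * δ ≤ ε / 400) (hε2 : ε < 2) {p : Finset (Fin n) → ℝ}
    (hp : p = fun Δ =>
      ((triangleSampler n Q K l).output (vertexStream nb P) (some Δ)).toReal) :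
    1 / 80 ≤ ∑ Δ ∈ triangles G, p Δ ∧
      ∑ Δ ∈ triangles G, |p Δ / (∑ Δ ∈ triangles G, p Δ) - 1 / (triangles G).card| ≤ ε := by
  have hQ : 1 ≤ Q := NeZero.one_le
  have hcard := h.card_triangles hadj
  have ht0 : (0 : ℝ) < (triangles G).card := by exact_mod_cast ht.card_pos
  obtain ⟨c, hc, hsum⟩ := exists_sum_abs_expect_reportProb_sub_le (E := pairs nb P) (Q := Q) (K := K)
    (a := charge nb P) (w := fun σ : Seed Q l => seedWitnesses nb P σ)
    (s := fun σ : Seed Q l => sampledTokens nb P σ) hδ hQ hK (by rwa [← hcard]) (by rwa [← hcard])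
    (fun e he ha => h.expect_seedWitnesses_lt_le hl he ((Nat.zero_le _).trans_lt ha))
    h.expect_sum_seedWitnesses_le (fun σ e _ => sampledTokens_mul_self σ e)
    (fun σ e _ => sampledTokens_nonneg σ e) (fun e _ => expect_sampledTokens e)
    (fun e he e' he' hne => h.expect_sampledTokens_mul_le hl (h.symm (mem_pairs.1 he).2)
      (h.symm (mem_pairs.1 he').2) hne)
  rw [← hcard] at hc
  refine sum_abs_div_sub_le (triangles G) p ht hc hε hε2 ?_
  rw [h.sum_triangles hadj]
  refine le_trans (le_of_eq ?_) hsum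
  refine sum_congr rfl fun e he => sum_congr rfl fun j hj => ?_
  rw [hp]
  dsimp only
  rw [h.output_triangleAt (by omega) l he (Finset.mem_range.1 hj)]
  rfl

end IsVertexOrder

end TriangleStream


namespace TriangleStream

/-! ### Conditioning on success, and sizes of the stream -/

open BigOperators Finset

/-- The distribution of a success, conditioned on not failing. -/
theorem exists_conditional {α : Type} [Fintype α] (out : PMF (Option α)) (T : Finset α)
    (hT : T.Nonempty) (hsupp : ∀ x ∉ T, out (some x) = 0) {ε : ℝ}
    (hpos : 1 / 80 ≤ ∑ x ∈ T, (out (some x)).toReal)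
    (hclose : ∑ x ∈ T, |(out (some x)).toReal / (∑ x ∈ T, (out (some x)).toReal) - 1 / T.card| ≤ ε) :
    (out none).toReal ≤ 79 / 80 ∧ ∃ D : PMF α, (∀ x ∈ D.support, x ∈ T) ∧
      l1Dist D (PMF.uniformOfFinset T hT) ≤ ε ∧ ∀ x, out (some x) = (1 - out none) * D x := by
  classical
  set s := ∑ x, out (some x) with hs
  have hsT : s = ∑ x ∈ T, out (some x) :=
    (sum_subset (subset_univ T) fun x _ hx => hsupp x hx).symm
  have htotal : out none + s = 1 := by
    have h := out.tsum_coe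
    rwa [tsum_fintype, Fintype.sum_option] at h
  have hs_fin : s ≠ ⊤ := by
    intro h; rw [h] at htotal; simp at htotal
  have hsr : s.toReal = ∑ x ∈ T, (out (some x)).toReal := by
    rw [hsT, ENNReal.toReal_sum fun _ _ => PMF.apply_ne_top _ _]
  have hs0 : s ≠ 0 := by
    intro h; rw [← hsr, h] at hpos; norm_num at hpos
  have hs1 : 1 - out none = s := by
    rw [← htotal, add_comm]
    exact ENNReal.add_sub_cancel_right (PMF.apply_ne_top _ _)
  refine ⟨?_, PMF.ofFintype (fun x => out (some x) / s) ?_, ?_, ?_, ?_⟩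
  · have := congrArg ENNReal.toReal htotal
    rw [ENNReal.toReal_add (PMF.apply_ne_top _ _) hs_fin, hsr] at this
    simp only [ENNReal.toReal_one] at this
    linarith
  · simp_rw [div_eq_mul_inv]
    rw [← sum_mul, ← hs, ENNReal.mul_inv_cancel hs0 hs_fin]
  · intro x hx
    by_contra hxT
    rw [PMF.mem_support_iff, PMF.ofFintype_apply, hsupp x hxT] at hx
    simp at hx
  · refine le_trans (le_of_eq ?_) hclose
    rw [l1Dist, ← hsr]
    refine (sum_subset (subset_univ T) fun x _ hx => ?_).symm.trans (sum_congr rfl fun x hx => ?_)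
    · rw [PMF.ofFintype_apply, hsupp x hx, PMF.uniformOfFinset_apply_of_notMem _ hx]
      simp
    · rw [PMF.ofFintype_apply, PMF.uniformOfFinset_apply_of_mem _ hx, ENNReal.toReal_div,
        ENNReal.toReal_inv, ENNReal.toReal_natCast, one_div]
  · intro x
    rw [hs1, PMF.ofFintype_apply, ENNReal.mul_div_cancel hs0 hs_fin]

theorem samplesTriangle_repeated {n : ℕ} {G : SimpleGraph (Fin n)} [DecidableRel G.Adj]
    (A : Algorithm (Fin n × Fin n) (Option (Finset (Fin n)))) (s : List (Fin n × Fin n)) {ε δ : ℝ}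
    (hT : (triangles G).Nonempty) (hsupp : ∀ Δ ∉ triangles G, A.output s (some Δ) = 0)
    (hpos : 1 / 80 ≤ ∑ Δ ∈ triangles G, (A.output s (some Δ)).toReal)
    (hclose : ∑ Δ ∈ triangles G, |(A.output s (some Δ)).toReal /
      (∑ Δ ∈ triangles G, (A.output s (some Δ)).toReal) - 1 / (triangles G).card| ≤ ε)
    (k : ℕ) (hk : (79 / 80 : ℝ) ^ k ≤ δ) :
    SamplesTriangle G ε δ ((A.repeated k).output s) := by
  obtain ⟨h1, D, h2, h3, h4⟩ := exists_conditional (A.output s) _ hT hsupp hpos hclose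
  refine ⟨?_, hT, D, h2, h3, Algorithm.repeated_output_some A s D h4 k⟩
  rw [Algorithm.repeated_output_none, ENNReal.toReal_pow]
  exact (pow_le_pow_left₀ ENNReal.toReal_nonneg h1 k).trans hk

section Stream

variable {n : ℕ} {G : SimpleGraph (Fin n)}

/-- Isolated vertices send no tokens and are dropped from the order, so that the list of every
remaining vertex is noticed by the process. -/
theorem IsAdjacencyListStream.exists_isVertexOrder {s : List (Fin n × Fin n)}
    (hs : IsAdjacencyListStream G s) :
    ∃ nb P, IsVertexOrder nb P ∧ (∀ v w, w ∈ nb v ↔ G.Adj v w) ∧ s = vertexStream nb P := by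
  obtain ⟨order, nb, h1, h2, h3, rfl⟩ := hs
  have hadj : ∀ v w, w ∈ nb v ↔ G.Adj v w := fun v w => (h3 v).2 w
  refine ⟨nb, order.filter fun v => nb v ≠ [], ⟨h1.filter _, fun v => (h3 v).1, ?_, ?_, ?_⟩,
    hadj, ?_⟩
  · intro x y h
    rw [hadj] at h ⊢
    exact h.symm
  · intro v h
    rw [hadj] at h
    exact h.ne rfl
  · intro v
    simp [h2 v]
  · clear h1 h2
    induction order with
    | nil => rfl
    | cons v order ih =>
      rw [List.flatMap_cons, ih, List.filter_cons]
      by_cases hv : nb v = []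
      · simp [hv]
      · simp [hv, vertexStream]

theorem IsVertexOrder.length_vertexStream [DecidableRel G.Adj] {nb : Fin n → List (Fin n)}
    {P : List (Fin n)}
    (h : IsVertexOrder nb P) (hadj : ∀ v w, w ∈ nb v ↔ G.Adj v w) :
    (vertexStream nb P).length = 2 * G.edgeFinset.card := by
  rw [← G.sum_degrees_eq_twice_card_edges, vertexStream, List.length_flatMap,
    ← List.sum_toFinset _ h.nodup]
  have hdeg : ∀ v, (nb v).length = G.degree v := by
    intro v
    rw [← List.toFinset_card_of_nodup (h.nodup_nb v), ← G.card_neighborFinset_eq_degree]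
    congr 1
    ext w
    simp [hadj]
  simp only [List.length_map, hdeg]
  refine sum_subset (subset_univ _) fun v _ hv => ?_
  rw [List.mem_toFinset, h.mem_iff, not_not] at hv
  rw [← hdeg, hv]; rfl

/-- A triangle is determined by two tokens: its pair (x, y) and (x, z) for its apex z. The resulting
√T ≤ 2m lets m/√T absorb additive terms in the space. -/
theorem IsVertexOrder.card_triangles_le [DecidableRel G.Adj] {nb : Fin n → List (Fin n)}
    {P : List (Fin n)}
    (h : IsVertexOrder nb P) (hadj : ∀ v w, w ∈ nb v ↔ G.Adj v w) :
    (triangles G).card ≤ (2 * G.edgeFinset.card) ^ 2 := by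
  rw [← h.length_vertexStream hadj]
  have h1 : ((triangles G).card : ℝ) = (∑ e ∈ IsVertexOrder.pairs nb P, charge nb P e : ℕ) := by
    rw [h.card_triangles hadj]; push_cast; rfl
  rw [Nat.cast_inj.1 h1, sq]
  have hlen : (vertexStream nb P).toFinset.card = (vertexStream nb P).length :=
    List.toFinset_card_of_nodup h.nodup_vertexStream
  have h2 : (IsVertexOrder.pairs nb P).card ≤ (vertexStream nb P).length := by
    rw [← hlen]
    refine card_le_card fun e he => ?_
    rw [List.mem_toFinset]
    exact h.mem_vertexStream (h.symm (IsVertexOrder.mem_pairs.1 he).2)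
  refine (sum_le_card_nsmul _ _ _ fun e _ => ?_).trans (Nat.mul_le_mul_right _ h2)
  rw [← h.card_apexes, ← hlen]
  refine card_le_card_of_injOn (Prod.mk e.1) ?_ ((Prod.mk_right_injective e.1).injOn)
  intro z hz
  rw [Finset.mem_coe, List.mem_toFinset]
  exact h.mem_vertexStream (IsVertexOrder.mem_common.1 (h.apexes_subset_common e hz)).1

end Stream

/-! ### The choice of the parameters -/

/-- If the floor u is 0, then Q = 1 and the left side vanishes; otherwise u + 1 ≤ 2u. -/
theorem block_length_bound {K T t Q : ℕ} {ε : ℝ} (hε : 0 < ε) (hK : 1 ≤ K) (hT : T ≤ t)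
    (hQ : Q = ⌊ε / (3200 * K) * Real.sqrt T⌋₊ + 1) :
    ((Q : ℝ) - 1) * (2 * K * Q) ≤ (ε / 1600) ^ 2 * t := by
  have hK' : (1 : ℝ) ≤ K := by exact_mod_cast hK
  set u := ⌊ε / (3200 * K) * Real.sqrt T⌋₊ with hu
  have hfloor : (u : ℝ) ≤ ε / (3200 * K) * Real.sqrt T := Nat.floor_le (by positivity)
  have hQ1 : (Q : ℝ) = u + 1 := by rw [hQ]; push_cast; rfl
  rw [hQ1, add_sub_cancel_right]
  rcases Nat.eq_zero_or_pos u with h0 | h0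
  · rw [h0]; simp; positivity
  have h1 : (1 : ℝ) ≤ u := by exact_mod_cast h0
  have hT' : (T : ℝ) ≤ t := by exact_mod_cast hT
  have h2 : (u : ℝ) * (u + 1) ≤ 2 * u ^ 2 := by nlinarith
  calc (u : ℝ) * (2 * K * (u + 1)) = 2 * K * (u * (u + 1)) := by ring
    _ ≤ 2 * K * (2 * (u : ℝ) ^ 2) := by gcongr
    _ = 4 * K * (u : ℝ) ^ 2 := by ring
    _ ≤ 4 * K * (ε / (3200 * K) * Real.sqrt T) ^ 2 := by gcongr
    _ = (ε / 1600) ^ 2 * T / K := by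
        rw [mul_pow, Real.sq_sqrt (Nat.cast_nonneg T)]
        field_simp
        ring
    _ ≤ (ε / 1600) ^ 2 * T := div_le_self (by positivity) hK'
    _ ≤ (ε / 1600) ^ 2 * t := by gcongr

theorem size_le_three_mul_log {n : ℕ} (hn : 3 ≤ n) : (n.size : ℝ) ≤ 3 * Real.log n ∧ 1 ≤ Real.log n := by
  have hn0 : (0 : ℝ) < n := by positivity
  have hlog : 1 ≤ Real.log n := by
    rw [Real.le_log_iff_exp_le hn0]
    have : (3 : ℝ) ≤ n := by exact_mod_cast hn
    linarith [Real.exp_one_lt_d9]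
  refine ⟨?_, hlog⟩
  have h1 : 2 ^ (n.size - 1) ≤ n := by
    by_contra h
    push Not at h
    have := Nat.size_le.2 h
    have : 0 < n.size := Nat.size_pos.2 (by omega)
    omega
  have hs : 1 ≤ n.size := Nat.size_pos.2 (by omega)
  have h2 : ((n.size - 1 : ℕ) : ℝ) * Real.log 2 ≤ Real.log n := by
    rw [← Real.log_pow]
    exact Real.log_le_log (by positivity) (by exact_mod_cast h1)
  rw [Nat.cast_sub hs, Nat.cast_one] at h2
  nlinarith [Real.log_two_gt_d9]

theorem pow_ceil_le {n c : ℕ} (hn : 3 ≤ n) :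
    (79 / 80 : ℝ) ^ ⌈80 * c * Real.log n⌉₊ ≤ 1 / (n : ℝ) ^ c := by
  have hn0 : (0 : ℝ) < n := by positivity
  have h1 : (79 / 80 : ℝ) ≤ Real.exp (-(1 / 80)) := by
    have := Real.add_one_le_exp (-(1 / 80) : ℝ)
    linarith
  calc (79 / 80 : ℝ) ^ ⌈80 * c * Real.log n⌉₊
      ≤ Real.exp (-(1 / 80)) ^ ⌈80 * c * Real.log n⌉₊ := by gcongr
    _ = Real.exp (⌈80 * c * Real.log n⌉₊ * -(1 / 80)) := by rw [Real.exp_nat_mul]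
    _ ≤ Real.exp (-(c * Real.log n)) := by
        refine Real.exp_le_exp.2 ?_
        have := Nat.le_ceil (80 * c * Real.log n)
        linarith
    _ = 1 / (n : ℝ) ^ c := by
        rw [Real.exp_neg, ← Real.log_pow, Real.exp_log (by positivity), one_div]

/-- One logarithm comes from the number of copies, one from the bit length of a number, and one from
the number of residues in a seed. The factor 1/ε² arises because 1/Q is at most 3200K/(ε√T) and K is
about 3200/ε. -/
theorem space_bound {n m T K Q c : ℕ} {ε : ℝ} (hn : 3 ≤ n) (hε : 0 < ε) (hε2 : ε < 2)
    (hT : 1 ≤ T) (hTm : T ≤ (2 * m) ^ 2) (hK : K = ⌈3200 / ε⌉₊)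
    (hQ : Q = ⌊ε / (3200 * K) * Real.sqrt T⌋₊ + 1) :
    (⌈80 * c * Real.log n⌉₊ : ℝ) * (2 * (((8 * n.size + 1) *
        (31 + 4 * (2 * n.size) + 12 * (2 * m / Q)) : ℕ) : ℝ) + 1)
      ≤ (80 * c + 1) * 20000000000 * ((m : ℝ) / Real.sqrt T) * Real.log n ^ 3 * (1 / ε) ^ 2 := by
  obtain ⟨hz, hL⟩ := size_le_three_mul_log hn
  set L := Real.log n with hLdef
  have hsT : 0 < Real.sqrt T := Real.sqrt_pos.2 (by exact_mod_cast hT)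
  set X := (m : ℝ) / Real.sqrt T with hX
  set Y := (1 / ε) ^ 2 with hY
  -- The lower bounds on X and Y allow additive constants and logarithms to be absorbed into
  -- products.
  have hX2 : 1 / 2 ≤ X := by
    rw [hX, div_le_div_iff₀ two_pos hsT, one_mul]
    have : Real.sqrt T ≤ 2 * m := by
      rw [Real.sqrt_le_left (by positivity)]
      exact_mod_cast hTm
    linarith
  have hY4 : 1 / 4 ≤ Y := by
    have : 1 / 2 ≤ 1 / ε := one_div_le_one_div_of_le hε hε2.le
    rw [hY]; nlinarith
  have hK0 : 0 < K := by rw [hK]; exact Nat.ceil_pos.2 (by positivity)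
  have hK0' : (0 : ℝ) < K := by exact_mod_cast hK0
  have hKε : (K : ℝ) * ε ≤ 3202 := by
    have h1 : (K : ℝ) < 3200 / ε + 1 := by rw [hK]; exact Nat.ceil_lt_add_one (by positivity)
    have h2 : (K : ℝ) * ε ≤ (3200 / ε + 1) * ε := by gcongr
    rw [add_mul, div_mul_cancel₀ _ hε.ne'] at h2
    linarith
  have hQ0 : ε / (3200 * K) * Real.sqrt T ≤ Q := by
    rw [hQ]; push_cast; exact (Nat.lt_floor_add_one _).le
  have hη : 0 < ε / (3200 * K) * Real.sqrt T := by positivity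
  have hdiv : ((2 * m / Q : ℕ) : ℝ) ≤ 20492800 * (X * Y) := by
    calc ((2 * m / Q : ℕ) : ℝ) ≤ ((2 * m : ℕ) : ℝ) / Q := Nat.cast_div_le
      _ ≤ (2 * m : ℝ) / (ε / (3200 * K) * Real.sqrt T) := by push_cast; gcongr
      _ = 6400 * X * (K * ε) * Y := by
          rw [hX, hY]; field_simp; ring
      _ ≤ 6400 * X * 3202 * Y := by gcongr
      _ = 20492800 * (X * Y) := by ring
  have hXY : 1 / 8 ≤ X * Y := by nlinarith
  set Z := X * Y with hZ
  have hr : (⌈80 * c * L⌉₊ : ℝ) ≤ (80 * c + 1) * L := by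
    have := (Nat.ceil_lt_add_one (a := 80 * c * L) (by positivity)).le
    linarith
  have hS : (((8 * n.size + 1) * (31 + 4 * (2 * n.size) + 12 * (2 * m / Q)) : ℕ) : ℝ)
      ≤ 25 * L * (55 * L + 245913600 * Z) := by
    push_cast
    have hd : (0 : ℝ) ≤ ((2 * m / Q : ℕ) : ℝ) := Nat.cast_nonneg _
    refine mul_le_mul ?_ ?_ ?_ ?_
    · linarith
    · linarith
    · positivity
    · positivity
  have hS2 : 25 * L * (55 * L + 245913600 * Z) ≤ 6200000000 * (L ^ 2 * Z) := by
    have h1 : L ≤ L * (8 * Z) := le_mul_of_one_le_right (by linarith) (by linarith)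
    have h2 : Z ≤ L * Z := le_mul_of_one_le_left (by linarith) hL
    have h3 : 55 * L + 245913600 * Z ≤ 245914040 * (L * Z) := by nlinarith
    calc 25 * L * (55 * L + 245913600 * Z) ≤ 25 * L * (245914040 * (L * Z)) := by gcongr
      _ = 6147851000 * (L ^ 2 * Z) := by ring
      _ ≤ 6200000000 * (L ^ 2 * Z) := by
          have : 0 ≤ L ^ 2 * Z := by positivity
          linarith
  have h1 : 1 ≤ 8 * (L ^ 2 * Z) := by
    have : Z ≤ L ^ 2 * Z := le_mul_of_one_le_left (by linarith) (one_le_pow₀ hL)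
    linarith
  calc _ ≤ (80 * c + 1) * L * (2 * (6200000000 * (L ^ 2 * Z)) + 8 * (L ^ 2 * Z)) := by
        gcongr
        exact hS.trans hS2
    _ = (80 * c + 1) * 12400000008 * (L ^ 3 * Z) := by ring
    _ ≤ (80 * c + 1) * 20000000000 * (L ^ 3 * Z) := by gcongr; norm_num
    _ = _ := by rw [hZ]; ring

theorem counter_bound {n m T K Q : ℕ} {ε : ℝ} (hn : 3 ≤ n) (hε2 : ε < 2)
    (hTm : T ≤ (2 * m) ^ 2) (hK : 1 ≤ K) (hm : 2 * m + 1 ≤ n ^ 2)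
    (hQ : Q = ⌊ε / (3200 * K) * Real.sqrt T⌋₊ + 1) :
    3 * Q * (2 * m + 1) ^ 2 < 2 ^ (8 * n.size) := by
  have hK' : (1 : ℝ) ≤ K := by exact_mod_cast hK
  have hsqrt : Real.sqrt T ≤ 2 * m := by
    rw [Real.sqrt_le_left (by positivity)]
    exact_mod_cast hTm
  have hfloor : ⌊ε / (3200 * K) * Real.sqrt T⌋₊ ≤ 2 * m := by
    refine Nat.floor_le_of_le ?_
    push_cast
    have : ε / (3200 * K) ≤ 1 := by
      rw [div_le_one (by positivity)]; linarith
    calc ε / (3200 * K) * Real.sqrt T ≤ 1 * Real.sqrt T := by gcongr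
      _ ≤ 2 * m := by linarith
  have hQ' : Q ≤ n ^ 2 := by omega
  calc 3 * Q * (2 * m + 1) ^ 2 ≤ 3 * n ^ 2 * (n ^ 2) ^ 2 := by gcongr
    _ ≤ n ^ 8 := by
        have : 3 ≤ n ^ 2 := by nlinarith
        calc 3 * n ^ 2 * (n ^ 2) ^ 2 ≤ n ^ 2 * n ^ 2 * (n ^ 2) ^ 2 := by gcongr
          _ = n ^ 8 := by ring
    _ < (2 ^ n.size) ^ 8 := Nat.pow_lt_pow_left n.lt_size_self (by norm_num)
    _ = 2 ^ (8 * n.size) := by rw [← pow_mul, mul_comm]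

end TriangleStream

theorem mainTheorem1 :
    ∃ a b : ℕ, ∀ c : ℕ, ∃ C : ℝ, 0 < C ∧
      ∀ (n T : ℕ) (ε : ℝ), 1 ≤ T → 0 < ε → ε < 2 →
        ∃ A : TriangleStream.Algorithm (Fin n × Fin n) (Option (Finset (Fin n))),
          ∀ (G : SimpleGraph (Fin n)) [DecidableRel G.Adj] (s : List (Fin n × Fin n)),
            T ≤ (TriangleStream.triangles G).card →
            TriangleStream.IsAdjacencyListStream G s →
              A.UsesSpace s
                (C * ((G.edgeFinset.card : ℝ) / Real.sqrt T) * Real.log n ^ a * (1 / ε) ^ b) ∧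
              TriangleStream.SamplesTriangle G ε (1 / (n : ℝ) ^ c) (A.output s) := by
  refine ⟨3, 2, fun c => ⟨(80 * c + 1) * 20000000000, by positivity, fun n T ε hT hε hε2 => ?_⟩⟩
  -- With δ = ε/1600 the error 4/K + 2δ is at most ε/800 + ε/800, the ε/400 required for
  -- normalizing.
  obtain ⟨K, hK⟩ : ∃ K, K = ⌈3200 / ε⌉₊ := ⟨_, rfl⟩
  obtain ⟨Q, hQ⟩ : ∃ Q, Q = ⌊ε / (3200 * K) * Real.sqrt T⌋₊ + 1 := ⟨_, rfl⟩
  have : NeZero Q := ⟨by omega⟩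
  -- 2·`n.size` bits address all 2m < n² positions of the stream. Since 79/80 ≤ exp(-1/80), 80·c·log
  -- n copies bring the failure probability down to n^(-c).
  refine ⟨(TriangleStream.triangleSampler n Q K (2 * n.size)).repeated ⌈80 * c * Real.log n⌉₊,
    fun G _ s hTG hs => ?_⟩
  obtain ⟨nb, P, h, hadj, rfl⟩ := hs.exists_isVertexOrder
  have hne : (TriangleStream.triangles G).Nonempty := Finset.card_pos.1 (by omega)
  -- As T ≥ 1 there is a triangle, so n ≥ 3 and log n ≥ 1.
  have hn : 3 ≤ n := by
    obtain ⟨Δ, hΔ⟩ := hne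
    rw [TriangleStream.triangles, SimpleGraph.mem_cliqueFinset_iff] at hΔ
    rw [← hΔ.card_eq]
    simpa using Finset.card_le_univ Δ
  have hlen := h.length_vertexStream hadj
  have hTm : T ≤ (2 * G.edgeFinset.card) ^ 2 := hTG.trans (h.card_triangles_le hadj)
  have hm : 2 * G.edgeFinset.card + 1 ≤ n ^ 2 := by
    rw [← G.sum_degrees_eq_twice_card_edges]
    have : ∑ v, G.degree v ≤ n * (n - 1) := by
      refine (Finset.sum_le_card_nsmul _ _ (n - 1) fun v _ => ?_).trans (by simp)
      have := G.degree_lt_card_verts v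
      rw [Fintype.card_fin] at this
      omega
    obtain ⟨k, rfl⟩ : ∃ k, n = k + 1 := ⟨n - 1, by omega⟩
    simp only [Nat.add_sub_cancel] at this
    nlinarith
  have hK' : (3200 / ε : ℝ) ≤ K := by rw [hK]; exact Nat.le_ceil _
  have hK16 : 16 ≤ K := by
    have : (16 : ℝ) ≤ 3200 / ε := by rw [le_div_iff₀ hε]; linarith
    exact_mod_cast this.trans hK'
  constructor
  · have hcounter := TriangleStream.counter_bound hn hε2 hTm (by omega) hm hQ
    have hspace := TriangleStream.triangleSampler_usesSpace (K := K) (Q := Q) (l := 2 * n.size)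
      (TriangleStream.vertexStream nb P) (b := 8 * n.size)
      (n.lt_size_self.le.trans (Nat.pow_le_pow_right (by norm_num) (by omega))) (by rwa [hlen])
    rw [hlen] at hspace
    intro r hr q hq
    exact (TriangleStream.Algorithm.repeated_usesSpace hspace _ r hr q hq).trans
      (TriangleStream.space_bound hn hε hε2 hT hTm hK hQ)
  · obtain ⟨h1, h2⟩ := h.output_close_to_uniform (K := K) (Q := Q) (l := 2 * n.size) hadj
      (by
        rw [hlen]
        calc 2 * G.edgeFinset.card ≤ n ^ 2 := by omega
          _ ≤ (2 ^ n.size) ^ 2 := Nat.pow_le_pow_left n.lt_size_self.le 2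
          _ = 2 ^ (2 * n.size) := by rw [← pow_mul, mul_comm])
      (δ := ε / 1600) (ε := ε) (by positivity) hK16 hne
      (TriangleStream.block_length_bound hε (by omega) hTG hQ)
      (by
        have : 4 / (K : ℝ) ≤ ε / 800 := by
          rw [div_le_iff₀ (by positivity)]
          rw [div_le_iff₀ hε] at hK'
          linarith
        linarith) hε2 rfl
    exact TriangleStream.samplesTriangle_repeated _ _ hne
      (fun Δ hΔ => h.output_of_notMem hadj (by omega) hΔ) h1 h2 _ (TriangleStream.pow_ceil_le hn)
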